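/- **Setting.** Let $F$ be a germ at $0$ of a biholomorphism of $\mathbb C^n$ with $F(0)=0$ and diagonal differential $dF_0=D=\mathrm{Diag}(\lambda_1,\dots,\lambda_n)$. Write $\mathbb N=\{0,1,2,\dots\}$, $|L|=\sum_j L_j$ for a multi-index, and $e_s$ for the $s$-th unit multi-index. *Resonances.* $F$ is *$m$-resonant with respect to all eigenvalues* if there are multi-indices $P^1,\dots,P^m\in\mathbb N^n$, linearly independent over $\mathbb Q$, such that the pairs $(s,L)$ with $1\le s\le n$, $L\in\mathbb N^n$, $|L|\ge 2$ and $\lambda^L=\lambda_s$ are precisely those with $L=e_s+K\mathbf P$ for some $K\in\mathbb N^m$ with $|K|\ge1$, where $K\mathbf P:=k_1P^1+\dots+k_mP^m$. *Normal forms, weighted order.* A *Poincaré–Dulac normal form* of $F$ is a formal map $\widetilde F$, conjugate to $F$ by a (possibly only formal) change of coordinates at $0$, of the form $$\widetilde F_s(z)=\lambda_s z_s+\sum_{K\in\mathbb N^m,\ K\ne0}a_{K,s}\,z^{K\mathbf P}z_s,\qquad s=1,\dots,n .$$ The *weighted order* of $F$ is the least $k_0=|K|\ge1$ for which $a_{K,s}\neq0$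 for some $s$; it is assumed to be finite. *Parabolic shadow.* To a normal form one associates $u\mapsto u+H(u)$ on $\mathbb C^m$, where $$H(u)_t=u_t\sum_{|K|=k_0}\Big(\sum_{j=1}^n P^t_j\,\frac{a_{K,j}}{\lambda_j}\Big)u^K,\qquad t=1,\dots,m .$$ A vector $v\in\mathbb C^m\setminus\{0\}$ is a *normalized representative of a fully attractive non-degenerate characteristic direction* if $H(v)=-\frac1{k_0}v$ and all eigenvalues of $\frac1{k_0}\big(d\widetilde H_{[v]}-\mathrm{id}\big)$ on $T_{[v]}\mathbb{CP}^{m-1}$ have positive real part, where $\widetilde H$ is the map $[u]\mapsto[H(u)]$ of $\mathbb{CP}^{m-1}$. $F$ is *parabolically attracting* if, for some normal form of $F$ and some such $v$, $$\mathrm{Re}\Big(\sum_{|K|=k_0}\frac{a_{K,j}}{\lambda_j}v^K\Big)<0\qquad\text{for all } j=1,\dots,n .$$ *Basins.* An *attracting basin* of a germ $G$ fixing $0$ is a nonempty open set $U\subset\mathbb C^n$ with $0\in\overline U$ for which there is a neighbourhood basis $\{\Omega_j\}$ of $0$ such that, for every $j$, $G(U\cap\Omega_j)\subset U\cap\Omega_j$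 and $G^{\circ l}(z)\to0$ as $l\to\infty$ for all $z\in U\cap\Omega_j$. A *repelling basin* of $F$ is an attracting basin of $F^{-1}$. **Corollary 5.2 (repelling basins).** Suppose that $F$ is $m$-resonant with respect to all eigenvalues $\lambda_1,\dots,\lambda_n$, of (finite) weighted order $k_0$, that $|\lambda_j|=1$ for all $j=1,\dots,n$, and that $F$ is parabolically attracting. Then $F$ has at least $k_0$ repelling basins, pairwise disjoint, each having $0$ on its boundary. -/

import Mathlib

open Filter Topology

noncomputable section

namespace MultiResonant

/-- The monomial `z ^ L = ∏ j, z_j ^ L_j` of a multi-index `L`. -/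
def monom {n : ℕ} (z : Fin n → ℂ) (L : Fin n →₀ ℕ) : ℂ :=
  ∏ j, z j ^ L j

/-! ### Germs of biholomorphisms of `ℂⁿ` fixing the origin, and their basins -/

/-- `G` represents the inverse of the germ at `0` represented by `F`. -/
structure IsInverseGerm {n : ℕ} (F G : (Fin n → ℂ) → (Fin n → ℂ)) : Prop where
  analyticAt : AnalyticAt ℂ G 0
  map_zero : G 0 = 0
  left_inv : ∀ᶠ z in 𝓝 (0 : Fin n → ℂ), G (F z) = z
  right_inv : ∀ᶠ z in 𝓝 (0 : Fin n → ℂ), F (G z) = z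

/-- `F` represents a germ of biholomorphism of `ℂⁿ` fixing `0`. Only the values of `F` near `0`
matter. -/
structure IsBiholGerm {n : ℕ} (F : (Fin n → ℂ) → (Fin n → ℂ)) : Prop where
  analyticAt : AnalyticAt ℂ F 0
  map_zero : F 0 = 0
  exists_inverse : ∃ G, IsInverseGerm F G

/-- The differential of `F` at `0` is the diagonal matrix with entries `lam 1, …, lam n`. -/
def HasDiagonalDifferential {n : ℕ} (F : (Fin n → ℂ) → (Fin n → ℂ)) (lam : Fin n → ℂ) : Prop :=
  ∀ z j, fderiv ℂ F 0 z j = lam j * z j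

/-- `U` is a (local) basin of attraction at `0` of the germ represented by `F`: a nonempty open set
with `0` in its closure such that, for some neighbourhood basis `Ω 0, Ω 1, …` of `0`, every
`U ∩ Ω j` is forward invariant and all orbits that start in it converge to `0`. -/
structure IsAttractingBasin {n : ℕ} (F : (Fin n → ℂ) → (Fin n → ℂ))
    (U : Set (Fin n → ℂ)) : Prop where
  nonempty : U.Nonempty
  isOpen : IsOpen U
  zero_mem_closure : (0 : Fin n → ℂ) ∈ closure U
  exists_basis : ∃ Ω : ℕ → Set (Fin n → ℂ),
    (𝓝 (0 : Fin n → ℂ)).HasBasis (fun _ => True) Ω ∧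
    (∀ j, Set.MapsTo F (U ∩ Ω j) (U ∩ Ω j)) ∧
    ∀ j, ∀ z ∈ U ∩ Ω j, Tendsto (fun l : ℕ => F^[l] z) atTop (𝓝 0)

/-- A repelling basin of `F` is a basin of attraction of the inverse germ. -/
def IsRepellingBasin {n : ℕ} (F : (Fin n → ℂ) → (Fin n → ℂ)) (U : Set (Fin n → ℂ)) : Prop :=
  ∃ G, IsInverseGerm F G ∧ IsAttractingBasin G U

/-! ### Resonances -/

/-- `K P = k_1 P^1 + ⋯ + k_m P^m`. -/
def comb {n m : ℕ} (P : Fin m → (Fin n →₀ ℕ)) (K : Fin m → ℕ) : Fin n →₀ ℕ :=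
  ∑ t, K t • P t

/-- `P^1, …, P^m` are the generators over `ℕ` of the resonances of `lam`, where `lam` is
`m`-resonant with respect to all its entries: the `P^t` are linearly independent over `ℚ`, and the
resonances, i.e. the pairs `(s, L)` with `|L| ≥ 2` and `lam ^ L = lam s`, are precisely those with
`L = e_s + k_1 P^1 + ⋯ + k_m P^m` for some natural numbers with `k_1 + ⋯ + k_m ≥ 1`. -/
structure IsResonantWithGenerators {n m : ℕ} (lam : Fin n → ℂ)
    (P : Fin m → (Fin n →₀ ℕ)) : Prop where
  linearIndependent : LinearIndependent ℚ (fun t : Fin m => fun j : Fin n => (P t j : ℚ))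
  resonances : ∀ (s : Fin n) (L : Fin n →₀ ℕ),
    (2 ≤ ∑ j, L j ∧ monom lam L = lam s) ↔
      ∃ K : Fin m → ℕ, 1 ≤ ∑ t, K t ∧ L = Finsupp.single s 1 + comb P K

/-! ### Poincaré-Dulac normal forms -/

/-- `T = (T_1, …, T_n)` is the power series expansion of `F` at `0`. -/
def HasExpansion {n : ℕ} (F : (Fin n → ℂ) → (Fin n → ℂ))
    (T : Fin n → MvPowerSeries (Fin n) ℂ) : Prop :=
  ∀ᶠ z in 𝓝 (0 : Fin n → ℂ), ∀ j,
    HasSum (fun L : Fin n →₀ ℕ => MvPowerSeries.coeff L (T j) * monom z L) (F z j)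

/-- `ψ` is a formal change of coordinates at `0`: no constant terms, invertible linear part. -/
structure IsFormalChange {n : ℕ} (ψ : Fin n → MvPowerSeries (Fin n) ℂ) : Prop where
  constantCoeff : ∀ j, MvPowerSeries.constantCoeff (ψ j) = 0
  linearPart : IsUnit (Matrix.of fun i j : Fin n =>
    MvPowerSeries.coeff (Finsupp.single j 1) (ψ i)).det

/-- `N` has the shape `N_s = lam_s z_s + ∑_{K ≠ 0} a_{K, s} z ^ {K P} z_s`, `s = 1, …, n`. -/
structure IsPoincareDulac {n m : ℕ} (lam : Fin n → ℂ) (P : Fin m → (Fin n →₀ ℕ))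
    (N : Fin n → MvPowerSeries (Fin n) ℂ) : Prop where
  linear : ∀ s, MvPowerSeries.coeff (Finsupp.single s 1) (N s) = lam s
  resonant : ∀ s L, MvPowerSeries.coeff L (N s) ≠ 0 →
    L = Finsupp.single s 1 ∨ ∃ K : Fin m → ℕ, K ≠ 0 ∧ L = Finsupp.single s 1 + comb P K

/-- `N` is a Poincaré-Dulac normal form of `F`: it is of Poincaré-Dulac shape, and some (possibly
only formal) change of coordinates `ψ` satisfies `ψ ∘ F = N ∘ ψ`. -/
def IsNormalFormOf {n m : ℕ} (F : (Fin n → ℂ) → (Fin n → ℂ)) (lam : Fin n → ℂ)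
    (P : Fin m → (Fin n →₀ ℕ)) (N : Fin n → MvPowerSeries (Fin n) ℂ) : Prop :=
  IsPoincareDulac lam P N ∧
    ∃ T ψ : Fin n → MvPowerSeries (Fin n) ℂ, HasExpansion F T ∧ IsFormalChange ψ ∧
      ∀ j, MvPowerSeries.subst T (ψ j) = MvPowerSeries.subst ψ (N j)

/-- The coefficient `a_{K, s}` of `z ^ {K P} z_s` in the `s`-th component of `N`. -/
def resCoeff {n m : ℕ} (P : Fin m → (Fin n →₀ ℕ)) (N : Fin n → MvPowerSeries (Fin n) ℂ)
    (K : Fin m → ℕ) (s : Fin n) : ℂ :=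
  MvPowerSeries.coeff (Finsupp.single s 1 + comb P K) (N s)

/-- `k₀` is the least `|K|`, `K ≠ 0`, such that `a_{K, s} ≠ 0` for some `s`. -/
def IsOrderOfNormalForm {n m : ℕ} (P : Fin m → (Fin n →₀ ℕ))
    (N : Fin n → MvPowerSeries (Fin n) ℂ) (k₀ : ℕ) : Prop :=
  IsLeast {k : ℕ | ∃ (K : Fin m → ℕ) (s : Fin n), K ≠ 0 ∧ ∑ t, K t = k ∧ resCoeff P N K s ≠ 0} k₀

/-- `F` has (finite) weighted order `k₀`. -/
def HasWeightedOrder {n m : ℕ} (F : (Fin n → ℂ) → (Fin n → ℂ)) (lam : Fin n → ℂ)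
    (P : Fin m → (Fin n →₀ ℕ)) (k₀ : ℕ) : Prop :=
  ∃ N, IsNormalFormOf F lam P N ∧ IsOrderOfNormalForm P N k₀

/-! ### The parabolic shadow and its characteristic directions -/

/-- `∑_{|K| = k₀} (a_{K, j} / lam_j) u ^ K`. -/
def fiberTerm {n m : ℕ} (lam : Fin n → ℂ) (P : Fin m → (Fin n →₀ ℕ))
    (N : Fin n → MvPowerSeries (Fin n) ℂ) (k₀ : ℕ) (j : Fin n) (u : Fin m → ℂ) : ℂ :=
  ∑ K ∈ Finset.piAntidiag (Finset.univ : Finset (Fin m)) k₀,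
    resCoeff P N K j / lam j * ∏ t, u t ^ K t

/-- The homogeneous part `H` of degree `k₀ + 1` of the parabolic shadow `u ↦ u + H u`; its `t`-th
component is `u_t ∑_{|K| = k₀} (∑_j p^t_j a_{K, j} / lam_j) u ^ K`. -/
def shadowH {n m : ℕ} (lam : Fin n → ℂ) (P : Fin m → (Fin n →₀ ℕ))
    (N : Fin n → MvPowerSeries (Fin n) ℂ) (k₀ : ℕ) (u : Fin m → ℂ) : Fin m → ℂ :=
  fun t => u t * ∑ K ∈ Finset.piAntidiag (Finset.univ : Finset (Fin m)) k₀,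
    (∑ j, (P t j : ℂ) * (resCoeff P N K j / lam j)) * ∏ t', u t' ^ K t'

/-- `α` is a director of the non-degenerate characteristic direction `[v]` of `u ↦ u + H u`, with
`H` homogeneous of degree `k₀ + 1`. Identify the tangent space of projective space at `[v]` with
`ℂᵐ / ℂ v`. As `H v = τ v` with `τ ≠ 0`, the map `[u] ↦ [H u]` fixes `[v]` and its differential there
is induced on `ℂᵐ / ℂ v` by `w ↦ τ⁻¹ (dH_v w)`; the directors are the eigenvalues on `ℂᵐ / ℂ v` of
`(1 / k₀) (τ⁻¹ dH_v - id)`, whose eigenvectors are represented by vectors `w` outside `ℂ v`. -/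
def IsDirector {m : ℕ} (k₀ : ℕ) (H : (Fin m → ℂ) → (Fin m → ℂ)) (v : Fin m → ℂ) (α : ℂ) : Prop :=
  ∃ τ : ℂ, τ ≠ 0 ∧ H v = τ • v ∧ ∃ w : Fin m → ℂ, w ∉ Submodule.span ℂ {v} ∧
    (1 / (k₀ : ℂ)) • (τ⁻¹ • fderiv ℂ H v w - w) - α • w ∈ Submodule.span ℂ {v}

/-- `v` is a normalized representative (`H v = -(1 / k₀) v`) of a fully attractive non-degenerate
characteristic direction of `u ↦ u + H u`: all directors have positive real part. -/
structure IsNormalizedFullyAttractive {m : ℕ} (k₀ : ℕ) (H : (Fin m → ℂ) → (Fin m → ℂ))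
    (v : Fin m → ℂ) : Prop where
  ne_zero : v ≠ 0
  normalized : H v = (-(1 / (k₀ : ℂ))) • v
  directors : ∀ α : ℂ, IsDirector k₀ H v α → 0 < α.re

/-- `F`, of weighted order `k₀`, is parabolically attracting (with respect to all eigenvalues):
for the parabolic shadow `u ↦ u + H u` given by some normal form `N` of `F`, and for some normalized
representative `v` of a fully attractive non-degenerate characteristic direction of it,
`Re (∑_{|K| = k₀} (a_{K, j} / lam_j) v ^ K) < 0` for all `j`. -/
def IsParabolicallyAttracting {n m : ℕ} (F : (Fin n → ℂ) → (Fin n → ℂ)) (lam : Fin n → ℂ)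
    (P : Fin m → (Fin n →₀ ℕ)) (k₀ : ℕ) : Prop :=
  ∃ N, IsNormalFormOf F lam P N ∧ IsOrderOfNormalForm P N k₀ ∧
    ∃ v : Fin m → ℂ, IsNormalizedFullyAttractive k₀ (shadowH lam P N k₀) v ∧
      ∀ j, (fiberTerm lam P N k₀ j v).re < 0

end MultiResonant

end

open Filter Topology

noncomputable section

namespace MultiResonant

/-! In normal form coordinates `F` multiplies `w_j` by `lam_j (1 + f_j(u) + ⋯)`, where `u = w ^ P`
and `f_j`, the `fiberTerm`, is homogeneous of degree `k₀`. Since `lam ^ P^t = 1`, the variable `u`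
evolves by its own shadow `u + H(u) + ⋯`. To leading order the inverse germ replaces `f_j` by `-f_j`
and `H` by `-H`. Because `H(v) = -v / k₀`, each of the `k₀` solutions of `σ ^ k₀ = -1` gives a
solution `σ t ^ (-1 / k₀) v` of the differential equation `du/dt = -H(u)`. Along it `-f_j(u) =
f_j(v) / t`, so `Re f_j(v) < 0` makes `|w_j|` decay like a negative power of `t`. There is one basin
per root `σ`.

A basin is a union, over large times, of sets `timeSlice`: the rescaled `u` is close to `v` and
`|w_j| < t ^ (-β)`. One step of the inverse maps the slice at time `t` into the slice at time `t +
1` (`eventually_mem_timeSlice`). The deviation `y` of the rescaled `u` from `v` becomes `y - A y / t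
+ ⋯` with `A = directorMap`. The eigenvalues of `A` are `1` or directors
(`re_pos_of_directorMap_eigenvalue`), so this contracts an adapted norm
(`exists_seminorm_contracting`).

The conjugation to the normal form may diverge. Truncated at degree `d`, it is a polynomial change
of coordinates with an error of order `‖z‖ ^ (d + 1)` (`IsNormalFormOf.exists_jet_conjugation`). As
`z = O(t ^ (-β))` on the slices, this error is negligible once `d` is large.

It remains to see that slices exist (`eventually_exists_mem_timeSlice`, delicate when `v` has zero
coordinates), that their union is a basin (`exists_basin_of_slices`), and that different phases `σ`
give disjoint sets (`disjoint_rescaled`). -/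

open Asymptotics

/-! ### Taylor polynomials and formal substitution. -/

/-- `p` is a Taylor expansion of `h` at `0` up to total degree `d`. -/
def HasTaylor {n : ℕ} (d : ℕ) (h : (Fin n → ℂ) → ℂ) (p : MvPowerSeries (Fin n) ℂ) : Prop :=
  ∃ Q : MvPolynomial (Fin n) ℂ,
    (∀ L : Fin n →₀ ℕ, L.degree ≤ d → Q.coeff L = MvPowerSeries.coeff L p) ∧
    (fun z => h z - MvPolynomial.eval z Q) =O[𝓝 0] fun z => ‖z‖ ^ (d + 1)

lemma norm_monom_le {n : ℕ} (z : Fin n → ℂ) (L : Fin n →₀ ℕ) :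
    ‖monom z L‖ ≤ ‖z‖ ^ L.degree := by
  rw [monom, norm_prod, Finsupp.degree_eq_sum, ← Finset.prod_pow_eq_pow_sum]
  refine Finset.prod_le_prod (fun _ _ => norm_nonneg _) fun j _ => ?_
  rw [norm_pow]
  exact pow_le_pow_left₀ (norm_nonneg _) (norm_le_pi_norm z j) _

lemma eval_monomial_eq_monom {n : ℕ} (z : Fin n → ℂ) (L : Fin n →₀ ℕ) (c : ℂ) :
    MvPolynomial.eval z (MvPolynomial.monomial L c) = c * monom z L := by
  rw [MvPolynomial.eval_monomial, monom, Finsupp.prod_fintype]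
  simp

lemma eventually_norm_le_one {n : ℕ} : ∀ᶠ z : Fin n → ℂ in 𝓝 0, ‖z‖ ≤ 1 := by
  filter_upwards [Metric.closedBall_mem_nhds (0 : Fin n → ℂ) one_pos] with z hz
  simpa using hz

lemma eval_isBigO_of_coeff_eq_zero {n d : ℕ} (Q : MvPolynomial (Fin n) ℂ)
    (hQ : ∀ L : Fin n →₀ ℕ, L.degree ≤ d → Q.coeff L = 0) :
    (fun z => MvPolynomial.eval z Q) =O[𝓝 0] fun z => ‖z‖ ^ (d + 1) := by
  have hsum : (fun z => MvPolynomial.eval z Q) =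
      fun z => ∑ L ∈ Q.support, Q.coeff L * monom z L := by
    funext z
    conv_lhs => rw [Q.as_sum, map_sum]
    simp only [eval_monomial_eq_monom]
  rw [hsum]
  refine (IsBigO.sum (s := Q.support) (A := fun L z => Q.coeff L * monom z L)
    fun L hL => ?_).congr_left fun z => by simp
  have hd : d + 1 ≤ L.degree := by
    by_contra hlt
    exact (MvPolynomial.mem_support_iff.mp hL) (hQ L (by omega))
  have hm : (fun z : Fin n → ℂ => monom z L) =O[𝓝 0] fun z => ‖z‖ ^ (d + 1) := by
    refine IsBigO.of_bound 1 ?_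
    filter_upwards [eventually_norm_le_one] with z hz
    rw [one_mul, Real.norm_of_nonneg (by positivity)]
    exact (norm_monom_le z L).trans (pow_le_pow_of_le_one (norm_nonneg _) hz hd)
  exact hm.const_mul_left _

lemma eval_isBigO_one {n : ℕ} (Q : MvPolynomial (Fin n) ℂ) :
    (fun z => MvPolynomial.eval z Q) =O[𝓝 0] fun _ => (1 : ℝ) :=
  (MvPolynomial.continuous_eval Q).continuousAt.isBigO_one ℝ

lemma norm_pow_isBigO_one {n : ℕ} (d : ℕ) :
    (fun z : Fin n → ℂ => ‖z‖ ^ d) =O[𝓝 0] fun _ => (1 : ℝ) :=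
  (continuous_norm.pow d).continuousAt.isBigO_one ℝ

namespace HasTaylor

variable {n d : ℕ} {h h₁ h₂ : (Fin n → ℂ) → ℂ} {p p₁ p₂ : MvPowerSeries (Fin n) ℂ}

lemma of_polynomial (Q : MvPolynomial (Fin n) ℂ)
    (hQ : ∀ L : Fin n →₀ ℕ, L.degree ≤ d → Q.coeff L = MvPowerSeries.coeff L p) :
    HasTaylor d (fun z => MvPolynomial.eval z Q) p :=
  ⟨Q, hQ, by simpa using isBigO_zero _ _⟩

lemma add (H₁ : HasTaylor d h₁ p₁) (H₂ : HasTaylor d h₂ p₂) :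
    HasTaylor d (fun z => h₁ z + h₂ z) (p₁ + p₂) := by
  obtain ⟨Q₁, hQ₁, e₁⟩ := H₁
  obtain ⟨Q₂, hQ₂, e₂⟩ := H₂
  refine ⟨Q₁ + Q₂, fun L hL => by simp [hQ₁ L hL, hQ₂ L hL], (e₁.add e₂).congr_left fun z => ?_⟩
  simp only [map_add]
  ring

lemma mul (H₁ : HasTaylor d h₁ p₁) (H₂ : HasTaylor d h₂ p₂) :
    HasTaylor d (fun z => h₁ z * h₂ z) (p₁ * p₂) := by
  obtain ⟨Q₁, hQ₁, e₁⟩ := H₁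
  obtain ⟨Q₂, hQ₂, e₂⟩ := H₂
  refine ⟨Q₁ * Q₂, fun L hL => ?_, ?_⟩
  · rw [MvPolynomial.coeff_mul, MvPowerSeries.coeff_mul]
    refine Finset.sum_congr rfl fun x hx => ?_
    have hx' : x.1.degree + x.2.degree = L.degree := by
      rw [← map_add, Finset.HasAntidiagonal.mem_antidiagonal.mp hx]
    rw [hQ₁ _ (by omega), hQ₂ _ (by omega)]
  · have hb : h₂ =O[𝓝 0] fun _ => (1 : ℝ) :=
      ((e₂.trans (norm_pow_isBigO_one _)).add (eval_isBigO_one Q₂)).congr_left fun z => by ring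
    refine ((e₁.mul hb).congr_right (g₂ := fun z => ‖z‖ ^ (d + 1)) fun z => by ring).add
      (((eval_isBigO_one Q₁).mul e₂).congr_right (g₂ := fun z => ‖z‖ ^ (d + 1)) fun z => by ring)
      |>.congr_left fun z => ?_
    simp only [map_mul]
    ring

lemma eval_polynomial {ι : Type*} {g : ι → (Fin n → ℂ) → ℂ} {a : ι → MvPowerSeries (Fin n) ℂ}
    (H : ∀ i, HasTaylor d (g i) (a i)) (Q : MvPolynomial ι ℂ) :
    HasTaylor d (fun z => MvPolynomial.eval (fun i => g i z) Q) (MvPolynomial.aeval a Q) := by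
  induction Q using MvPolynomial.induction_on with
  | C c =>
    refine ⟨MvPolynomial.C c, fun L _ => ?_, by simpa using isBigO_zero _ _⟩
    rw [MvPolynomial.aeval_C, MvPowerSeries.algebraMap_apply, ← MvPolynomial.coeff_coe,
      MvPolynomial.coe_C]
    rfl
  | add p q hp hq => simpa using hp.add hq
  | mul_X p i hp => simpa using hp.mul (H i)

/-- The inner series have no constant term, so up to degree `d` the composite depends only on the
outer series up to degree `d`. Any polynomial with the same low coefficients may therefore replace
it. -/
lemma eval_subst {g : Fin n → (Fin n → ℂ) → ℂ} {a : Fin n → MvPowerSeries (Fin n) ℂ}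
    (H : ∀ i, HasTaylor d (g i) (a i)) (ha : ∀ i, MvPowerSeries.constantCoeff (a i) = 0)
    (Q : MvPolynomial (Fin n) ℂ)
    (hQ : ∀ L : Fin n →₀ ℕ, L.degree ≤ d → Q.coeff L = MvPowerSeries.coeff L p) :
    HasTaylor d (fun z => MvPolynomial.eval (fun i => g i z) Q) (MvPowerSeries.subst a p) := by
  obtain ⟨R, hR, e⟩ := eval_polynomial H Q
  refine ⟨R, fun L hL => ?_, e⟩
  have htr : MvPowerSeries.truncTotal (d + 1) (Q : MvPowerSeries (Fin n) ℂ) =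
      MvPowerSeries.truncTotal (d + 1) p := by
    ext L
    by_cases hL : L.degree < d + 1
    · rw [MvPowerSeries.coeff_truncTotal _ hL, MvPowerSeries.coeff_truncTotal _ hL,
        MvPolynomial.coeff_coe, hQ L (by omega)]
    · rw [MvPowerSeries.coeff_truncTotal_eq_zero _ (by omega),
        MvPowerSeries.coeff_truncTotal_eq_zero _ (by omega)]
  have h1 := MvPowerSeries.truncTotal_subst (f := (Q : MvPowerSeries (Fin n) ℂ)) (k := d + 1) ha
  rw [htr, ← MvPowerSeries.truncTotal_subst ha, MvPowerSeries.subst_coe] at h1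
  rw [hR L hL, ← MvPowerSeries.coeff_truncTotal _ (show L.degree < d + 1 by omega), h1,
    MvPowerSeries.coeff_truncTotal _ (show L.degree < d + 1 by omega)]

/-- This converts an identity of formal series into an estimate between functions. -/
lemma sub_isBigO (H₁ : HasTaylor d h₁ p) (H₂ : HasTaylor d h₂ p) :
    (fun z => h₁ z - h₂ z) =O[𝓝 0] fun z => ‖z‖ ^ (d + 1) := by
  obtain ⟨Q₁, hQ₁, e₁⟩ := H₁
  obtain ⟨Q₂, hQ₂, e₂⟩ := H₂
  have e := eval_isBigO_of_coeff_eq_zero (d := d) (Q₁ - Q₂)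
    fun L hL => by simp [hQ₁ L hL, hQ₂ L hL]
  refine ((e₁.sub e₂).add e).congr_left fun z => ?_
  simp only [map_sub]
  ring

end HasTaylor

lemma finite_degree_le {n : ℕ} (d : ℕ) : {L : Fin n →₀ ℕ | L.degree ≤ d}.Finite := by
  simpa using Finsupp.finite_of_degree_le (σ := Fin n) d

/-- Convergence at the single point `(ρ, …, ρ)` makes `‖c L‖ * ρ ^ |L|` summable. Inside radius `ρ`
the terms of degree above `d` then gain a common factor `(‖z‖ / ρ) ^ (d + 1)`. -/
lemma HasExpansion.hasTaylor {n : ℕ} {F : (Fin n → ℂ) → (Fin n → ℂ)}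
    {T : Fin n → MvPowerSeries (Fin n) ℂ} (hT : HasExpansion F T) (d : ℕ) (j : Fin n) :
    HasTaylor d (fun z => F z j) (T j) := by
  classical
  set c : (Fin n →₀ ℕ) → ℂ := fun L => MvPowerSeries.coeff L (T j) with hc
  obtain ⟨r, hr, hball⟩ := Metric.eventually_nhds_iff_ball.mp hT
  set ρ : ℝ := r / 2 with hρ
  have hρ0 : 0 < ρ := by positivity
  have hρz : ‖(fun _ => (ρ : ℂ) : Fin n → ℂ)‖ < r := by
    refine (pi_norm_const_le _).trans_lt ?_
    rw [Complex.norm_real, Real.norm_of_nonneg hρ0.le]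
    simp only [hρ]; linarith
  have hsρ : Summable fun L : Fin n →₀ ℕ => ‖c L‖ * ρ ^ L.degree := by
    have := (hball (fun _ => (ρ : ℂ)) (by simpa using hρz) j).summable.norm
    refine this.congr fun L => ?_
    rw [norm_mul, monom, norm_prod, Finsupp.degree_eq_sum, ← Finset.prod_pow_eq_pow_sum]
    simp [abs_of_pos hρ0, hc]
  refine ⟨MvPowerSeries.truncTotal (d + 1) (T j), fun L hL =>
    MvPowerSeries.coeff_truncTotal _ (by omega), ?_⟩
  set S : Finset (Fin n →₀ ℕ) := (finite_degree_le d).toFinset with hS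
  have hmemS : ∀ L, L ∈ S ↔ L.degree ≤ d := fun L => by simp [hS]
  have heval : ∀ z : Fin n → ℂ, MvPolynomial.eval z (MvPowerSeries.truncTotal (d + 1) (T j)) =
      ∑ L ∈ S, c L * monom z L := by
    intro z
    have : MvPowerSeries.truncTotal (d + 1) (T j) = ∑ L ∈ S, MvPolynomial.monomial L (c L) := by
      ext L
      rw [MvPolynomial.coeff_sum]
      simp only [MvPolynomial.coeff_monomial]
      rw [Finset.sum_ite_eq' S L]
      by_cases hL : L.degree ≤ d
      · rw [if_pos ((hmemS L).mpr hL), MvPowerSeries.coeff_truncTotal _ (by omega)]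
      · rw [if_neg (fun h => hL ((hmemS L).mp h)),
          MvPowerSeries.coeff_truncTotal_eq_zero _ (by omega)]
    rw [this, map_sum]
    simp only [eval_monomial_eq_monom]
  set M : ℝ := ∑' L : Fin n →₀ ℕ, ‖c L‖ * ρ ^ L.degree with hM
  refine IsBigO.of_bound (M / ρ ^ (d + 1)) ?_
  filter_upwards [Metric.ball_mem_nhds (0 : Fin n → ℂ) hρ0] with z hz
  have hz' : ‖z‖ < ρ := by simpa using hz
  have hsum := hball z (by simp only [Metric.mem_ball, dist_zero_right]; linarith) j
  have hterm : ∀ L : {L // L ∉ S}, ‖c L * monom z L‖ ≤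
      (‖c L‖ * ρ ^ (L : Fin n →₀ ℕ).degree) * (‖z‖ / ρ) ^ (d + 1) := by
    rintro ⟨L, hL⟩
    have hLd : d + 1 ≤ L.degree := by
      by_contra hlt
      exact hL ((hmemS L).mpr (by omega))
    rw [norm_mul, mul_assoc]
    refine mul_le_mul_of_nonneg_left ((norm_monom_le z L).trans ?_) (norm_nonneg _)
    have h1 : ‖z‖ ^ L.degree = ρ ^ L.degree * (‖z‖ / ρ) ^ L.degree := by
      rw [← mul_pow, mul_div_cancel₀ _ hρ0.ne']
    rw [h1]
    refine mul_le_mul_of_nonneg_left ?_ (by positivity)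
    exact pow_le_pow_of_le_one (by positivity) ((div_le_one hρ0).mpr hz'.le) hLd
  have hrest : F z j - ∑ L ∈ S, c L * monom z L =
      ∑' L : {L // L ∉ S}, c L * monom z L := by
    rw [← hsum.tsum_eq, ← hsum.summable.sum_add_tsum_subtype_compl S]
    ring
  rw [heval, hrest]
  have hsub : Summable fun L : {L // L ∉ S} =>
      (‖c L‖ * ρ ^ (L : Fin n →₀ ℕ).degree) * (‖z‖ / ρ) ^ (d + 1) :=
    (hsρ.subtype _).mul_right _
  refine (tsum_of_norm_bounded hsub.hasSum hterm).trans ?_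
  rw [tsum_mul_right, Real.norm_of_nonneg (by positivity), div_pow]
  have : ∑' L : {L // L ∉ S}, ‖c L‖ * ρ ^ (L : Fin n →₀ ℕ).degree ≤ M :=
    Summable.tsum_subtype_le _ {L | L ∉ S} (fun L => by positivity) hsρ
  calc _ ≤ M * (‖z‖ ^ (d + 1) / ρ ^ (d + 1)) := by gcongr
    _ = _ := by ring

lemma HasExpansion.constantCoeff {n : ℕ} {F : (Fin n → ℂ) → (Fin n → ℂ)}
    {T : Fin n → MvPowerSeries (Fin n) ℂ} (hT : HasExpansion F T) (hF : F 0 = 0) (j : Fin n) :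
    MvPowerSeries.constantCoeff (T j) = 0 := by
  have h := hT.self_of_nhds j
  have h0 := hasSum_single (f := fun L : Fin n →₀ ℕ =>
    MvPowerSeries.coeff L (T j) * monom (0 : Fin n → ℂ) L) 0 fun L hL => by
      obtain ⟨i, hi⟩ := Finsupp.ne_iff.mp hL
      simp only [monom]
      rw [Finset.prod_eq_zero (Finset.mem_univ i), mul_zero]
      simpa using hi
  have := h0.unique h
  simpa [monom, hF] using this

/-! ### Adapted norms for linear contractions. -/

section AdaptedSeminorm

variable {E : Type*} [NormedAddCommGroup E] [NormedSpace ℂ E]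

/-- Applying `B` shifts the sum `∑_{k < N} ρ ^ (-k) ‖B ^ k y‖` by one place. The new last term,
which involves `B ^ N`, is at most `ρ` times the old first term `‖y‖`. -/
lemma exists_seminorm_contracting_of_norm_pow_lt (B : E →L[ℂ] E) {ρ : ℝ} (hρ : 0 < ρ) {N : ℕ}
    (hN : N ≠ 0) (hB : ‖B ^ N‖ ≤ ρ ^ N) :
    ∃ p : Seminorm ℂ E, (∀ y, ‖y‖ ≤ p y) ∧ (∃ C, 0 < C ∧ ∀ y, p y ≤ C * ‖y‖) ∧
      ∀ y, p (B y) ≤ ρ * p y := by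
  let p : Seminorm ℂ E := Seminorm.of
    (fun y => ∑ k ∈ Finset.range N, ρ⁻¹ ^ k * ‖(B ^ k) y‖)
    (fun x y => by
      rw [← Finset.sum_add_distrib]
      refine Finset.sum_le_sum fun k _ => ?_
      rw [map_add, ← mul_add]
      exact mul_le_mul_of_nonneg_left (norm_add_le _ _) (by positivity))
    (fun a y => by
      rw [Finset.mul_sum]
      refine Finset.sum_congr rfl fun k _ => ?_
      rw [map_smul, norm_smul]
      ring)
  have hp : ∀ y, p y = ∑ k ∈ Finset.range N, ρ⁻¹ ^ k * ‖(B ^ k) y‖ := fun y => rfl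
  have hlow : ∀ y, ‖y‖ ≤ p y := fun y => by
    rw [hp]
    refine le_trans ?_ (Finset.single_le_sum (fun k _ => by positivity)
      (Finset.mem_range.mpr (Nat.pos_of_ne_zero hN)))
    simp
  refine ⟨p, hlow, ⟨∑ k ∈ Finset.range N, ρ⁻¹ ^ k * ‖B ^ k‖ + 1, ?_, fun y => ?_⟩, fun y => ?_⟩
  · positivity
  · rw [hp, add_mul, Finset.sum_mul]
    refine le_add_of_le_of_nonneg (Finset.sum_le_sum fun k _ => ?_) (by positivity)
    rw [mul_assoc]
    exact mul_le_mul_of_nonneg_left ((B ^ k).le_opNorm y) (by positivity)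
  · obtain ⟨M, rfl⟩ := Nat.exists_eq_succ_of_ne_zero hN
    have h1 : ∀ k, (B ^ k) (B y) = (B ^ (k + 1)) y := fun k => by rw [pow_succ]; rfl
    rw [hp, hp, Finset.sum_range_succ, Finset.sum_range_succ', mul_add, Finset.mul_sum]
    refine add_le_add (Finset.sum_le_sum fun k _ => le_of_eq ?_) ?_
    · rw [h1, pow_succ ρ⁻¹]
      field_simp
    · rw [h1]
      calc ρ⁻¹ ^ M * ‖(B ^ (M + 1)) y‖ ≤ ρ⁻¹ ^ M * (ρ ^ (M + 1) * ‖y‖) := by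
            refine mul_le_mul_of_nonneg_left ?_ (by positivity)
            exact ((B ^ (M + 1)).le_opNorm y).trans
              (mul_le_mul_of_nonneg_right hB (norm_nonneg _))
        _ = _ := by
            simp only [pow_zero, one_mul, one_apply_eq_self]
            rw [pow_succ, inv_pow]
            field_simp

variable [FiniteDimensional ℂ E] [Nontrivial E]

/-- In finite dimension the spectrum consists of eigenvalues, so the spectral radius is below `1`.
Gelfand's formula gives the power `N`. -/
lemma exists_norm_pow_le_of_eigenvalues (B : E →L[ℂ] E)
    (hB : ∀ (β : ℂ) (w : E), w ≠ 0 → B w = β • w → ‖β‖ < 1) :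
    ∃ ρ : ℝ, 0 < ρ ∧ ρ < 1 ∧ ∃ N : ℕ, N ≠ 0 ∧ ‖B ^ N‖ ≤ ρ ^ N := by
  have : CompleteSpace E := FiniteDimensional.complete ℂ E
  have hrad : spectralRadius ℂ B < (1 : NNReal) := by
    refine spectrum.spectralRadius_lt_of_forall_lt B fun β hβ => ?_
    have h1 : β ∈ spectrum ℂ ((Module.End.toContinuousLinearMap E).symm B) := by
      rwa [AlgEquiv.spectrum_eq]
    rw [← Module.End.hasEigenvalue_iff_mem_spectrum] at h1
    obtain ⟨w, hw⟩ := h1.exists_hasEigenvector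
    have := hB β w hw.2 hw.apply_eq_smul
    exact_mod_cast this
  obtain ⟨ρ, h1, h2⟩ := ENNReal.lt_iff_exists_nnreal_btwn.mp hrad
  have hρ1 : (ρ : ℝ) < 1 := by exact_mod_cast h2
  have hρ0 : 0 < (ρ : ℝ) := by
    have : (0 : ENNReal) < ρ := lt_of_le_of_lt (by simp) h1
    exact_mod_cast this
  have ht := (spectrum.pow_norm_pow_one_div_tendsto_nhds_spectralRadius B).eventually_lt_const h1
  obtain ⟨N, hN, hN0⟩ := (ht.and (eventually_ne_atTop 0)).exists
  refine ⟨ρ, hρ0, hρ1, N, hN0, ?_⟩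
  rw [← ENNReal.ofReal_coe_nnreal, ENNReal.ofReal_lt_ofReal_iff hρ0] at hN
  calc ‖B ^ N‖ = (‖B ^ N‖ ^ (1 / N : ℝ)) ^ N := by
        rw [one_div, Real.rpow_inv_natCast_pow (norm_nonneg _) hN0]
    _ ≤ ρ ^ N := pow_le_pow_left₀ (by positivity) hN.le N

lemma eventually_norm_one_sub_mul_lt {α : ℂ} (hα : 0 < α.re) :
    ∀ᶠ s : ℝ in 𝓝[>] 0, ‖1 - (s : ℂ) * α‖ < 1 := by
  have hα0 : 0 < ‖α‖ ^ 2 := by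
    have : α ≠ 0 := fun h => by simp [h] at hα
    positivity
  filter_upwards [Ioo_mem_nhdsGT (show (0 : ℝ) < 2 * α.re / ‖α‖ ^ 2 by positivity)] with s hs
  have h2 : s * ‖α‖ ^ 2 < 2 * α.re := (lt_div_iff₀ hα0).mp hs.2
  have h3 : ‖1 - (s : ℂ) * α‖ ^ 2 = 1 - s * (2 * α.re - s * ‖α‖ ^ 2) := by
    rw [← Complex.normSq_eq_norm_sq, ← Complex.normSq_eq_norm_sq, Complex.normSq_apply,
      Complex.normSq_apply]
    simp
    ring
  have h4 : ‖1 - (s : ℂ) * α‖ ^ 2 < 1 := by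
    rw [h3]
    nlinarith [mul_pos hs.1 (sub_pos.mpr h2)]
  exact (sq_lt_one_iff₀ (norm_nonneg _)).mp h4

/-- Lyapunov's lemma: if all eigenvalues of `A` have positive real part, then `1 - s A` contracts
some norm for all small `s > 0`. -/
lemma exists_seminorm_contracting (A : E →L[ℂ] E)
    (hA : ∀ (α : ℂ) (w : E), w ≠ 0 → A w = α • w → 0 < α.re) :
    ∃ p : Seminorm ℂ E, (∀ y, ‖y‖ ≤ p y) ∧ (∃ C, 0 < C ∧ ∀ y, p y ≤ C * ‖y‖) ∧
      ∃ c > 0, ∃ s₀ > 0, ∀ s : ℝ, 0 ≤ s → s ≤ s₀ → ∀ y,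
        p (y - (s : ℂ) • A y) ≤ (1 - c * s) * p y := by
  have hfin : {α : ℂ | Module.End.HasEigenvalue (A : E →ₗ[ℂ] E) α}.Finite :=
    Module.End.finite_hasEigenvalue _
  have hev : ∀ᶠ s : ℝ in 𝓝[>] 0,
      ∀ α ∈ {α : ℂ | Module.End.HasEigenvalue (A : E →ₗ[ℂ] E) α}, ‖1 - (s : ℂ) * α‖ < 1 := by
    rw [eventually_all_finite hfin]
    intro α hα
    obtain ⟨w, hw⟩ := Module.End.HasEigenvalue.exists_hasEigenvector hα
    exact eventually_norm_one_sub_mul_lt (hA α w hw.2 hw.apply_eq_smul)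
  obtain ⟨s₀, hs, hs₀⟩ := (hev.and self_mem_nhdsWithin).exists
  have hs₀ : 0 < s₀ := hs₀
  have hsc : (s₀ : ℂ) ≠ 0 := by exact_mod_cast hs₀.ne'
  -- One step size `s₀` is enough: for `s ≤ s₀` the map `1 - s A` is a convex combination of the
  -- identity and `B`. This yields the rate `c = (1 - ρ) / s₀`.
  let B : E →L[ℂ] E := 1 - (s₀ : ℂ) • A
  have hBy : ∀ y, B y = y - (s₀ : ℂ) • A y := fun y => rfl
  obtain ⟨ρ, hρ0, hρ1, N, hN, hBN⟩ := exists_norm_pow_le_of_eigenvalues B fun β w hw hBw => by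
    have h1 : A w = ((1 - β) / s₀) • w := by
      rw [hBy] at hBw
      have h2 : (s₀ : ℂ) • A w = (1 - β) • w := by
        rw [sub_smul, one_smul, ← hBw]; abel
      rw [div_eq_inv_mul, mul_smul, ← h2, smul_smul, inv_mul_cancel₀ hsc, one_smul]
    have h3 := hs ((1 - β) / s₀)
      (Module.End.hasEigenvalue_of_hasEigenvector (x := w)
        ⟨Module.End.mem_eigenspace_iff.mpr h1, hw⟩)
    rwa [mul_div_cancel₀ _ hsc, sub_sub_cancel] at h3
  obtain ⟨p, hp1, hp2, hp3⟩ := exists_seminorm_contracting_of_norm_pow_lt B hρ0 hN hBN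
  refine ⟨p, hp1, hp2, (1 - ρ) / s₀, by have := sub_pos.mpr hρ1; positivity, s₀, hs₀,
    fun s hs1 hs2 y => ?_⟩
  have hr0 : 0 ≤ s / s₀ := by positivity
  have hr1 : s / s₀ ≤ 1 := (div_le_one hs₀).mpr hs2
  have hdec : y - (s : ℂ) • A y =
      ((1 - s / s₀ : ℝ) : ℂ) • y + ((s / s₀ : ℝ) : ℂ) • B y := by
    rw [hBy, smul_sub, smul_smul, ← add_sub_assoc, ← add_smul]
    push_cast
    rw [sub_add_cancel, one_smul, div_mul_cancel₀ _ hsc]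
  rw [hdec]
  refine (map_add_le_add p _ _).trans ?_
  rw [map_smul_eq_mul, map_smul_eq_mul, Complex.norm_real, Complex.norm_real,
    Real.norm_of_nonneg (sub_nonneg.mpr hr1), Real.norm_of_nonneg hr0]
  calc _ ≤ (1 - s / s₀) * p y + s / s₀ * (ρ * p y) := by gcongr; exact hp3 y
    _ = _ := by field_simp; ring

end AdaptedSeminorm

/-! ### The monomial map and the resonances. -/

/-- The monomial map `w ↦ (w ^ {P^1}, …, w ^ {P^m})`. -/
def monomMap {n m : ℕ} (P : Fin m → (Fin n →₀ ℕ)) (w : Fin n → ℂ) : Fin m → ℂ :=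
  fun t => monom w (P t)

lemma monom_add {n : ℕ} (z : Fin n → ℂ) (L L' : Fin n →₀ ℕ) :
    monom z (L + L') = monom z L * monom z L' := by
  simp [monom, pow_add, Finset.prod_mul_distrib]

lemma monom_single {n : ℕ} (z : Fin n → ℂ) (s : Fin n) :
    monom z (Finsupp.single s 1) = z s := by
  classical
  rw [monom, Finset.prod_eq_single s]
  · simp
  · intro j _ hj
    simp [Finsupp.single_eq_of_ne hj]
  · simp

lemma monom_comb {n m : ℕ} (P : Fin m → (Fin n →₀ ℕ)) (z : Fin n → ℂ) (K : Fin m → ℕ) :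
    monom z (comb P K) = ∏ t, monomMap P z t ^ K t := by
  simp only [monomMap, monom, comb, Finsupp.coe_finsetSum, Finset.sum_apply, Finsupp.smul_apply,
    smul_eq_mul]
  simp_rw [← Finset.prod_pow, ← pow_mul]
  rw [Finset.prod_comm]
  refine Finset.prod_congr rfl fun j _ => ?_
  rw [Finset.prod_pow_eq_pow_sum]
  congr 1
  exact Finset.sum_congr rfl fun t _ => mul_comm _ _

lemma continuous_monomMap {n m : ℕ} (P : Fin m → (Fin n →₀ ℕ)) :
    Continuous (monomMap P : (Fin n → ℂ) → Fin m → ℂ) := by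
  unfold monomMap monom
  fun_prop

section Resonant

variable {n m : ℕ} {lam : Fin n → ℂ} {P : Fin m → (Fin n →₀ ℕ)}

lemma comb_injective
    (h : LinearIndependent ℚ (fun t : Fin m => fun j : Fin n => (P t j : ℚ))) :
    Function.Injective (comb P) := by
  intro K K' hK
  have h1 : ∑ t, ((K t : ℚ) - K' t) • (fun j : Fin n => (P t j : ℚ)) = 0 := by
    funext j
    have := congrArg (fun L : Fin n →₀ ℕ => (L j : ℚ)) hK
    simp only [comb, Finsupp.coe_finsetSum, Finset.sum_apply, Finsupp.smul_apply,
      smul_eq_mul, Nat.cast_sum, Nat.cast_mul] at this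
    simp [sub_mul, Finset.sum_sub_distrib, this]
  funext t
  have := Fintype.linearIndependent_iff.mp h _ h1 t
  exact_mod_cast sub_eq_zero.mp this

lemma one_le_degree_generator
    (h : LinearIndependent ℚ (fun t : Fin m => fun j : Fin n => (P t j : ℚ))) (t : Fin m) :
    1 ≤ (P t).degree := by
  rw [Nat.one_le_iff_ne_zero, ne_eq, Finsupp.degree_eq_zero_iff]
  intro h0
  refine h.ne_zero t ?_
  funext j
  simp [h0]

lemma sum_le_degree_comb
    (h : LinearIndependent ℚ (fun t : Fin m => fun j : Fin n => (P t j : ℚ))) (K : Fin m → ℕ) :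
    ∑ t, K t ≤ (comb P K).degree := by
  rw [comb, map_sum]
  refine Finset.sum_le_sum fun t _ => ?_
  rw [map_nsmul, smul_eq_mul]
  exact Nat.le_mul_of_pos_right _ (one_le_degree_generator h t)

lemma monomMap_zero
    (h : LinearIndependent ℚ (fun t : Fin m => fun j : Fin n => (P t j : ℚ))) :
    monomMap P (0 : Fin n → ℂ) = 0 := by
  funext t
  have := norm_monom_le (0 : Fin n → ℂ) (P t)
  rw [norm_zero, zero_pow (by have := one_le_degree_generator h t; omega)] at this
  exact norm_le_zero_iff.mp this

lemma comb_zero : comb P 0 = 0 := by simp [comb]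

lemma comb_single (t : Fin m) : comb P (Pi.single t 1) = P t := by
  classical
  rw [comb, Finset.sum_eq_single t]
  · simp
  · intro t' _ ht'
    simp [ht']
  · simp

/-- For any index `s` the multi-index `e_s + P^t` is resonant, and `lam s` cancels. The condition `P
t ≠ 0` only serves to provide some `s`. As a consequence the linear part of `F` acts trivially on
`u`. -/
lemma IsResonantWithGenerators.monomMap_eq_one (h : IsResonantWithGenerators lam P)
    (hlam : ∀ j, ‖lam j‖ = 1) (t : Fin m) : monomMap P lam t = 1 := by
  classical
  have hP : P t ≠ 0 := fun h0 => by
    have := one_le_degree_generator h.linearIndependent t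
    simp [h0] at this
  obtain ⟨s, -⟩ := Finsupp.ne_iff.mp hP
  have h1 := ((h.resonances s (Finsupp.single s 1 + P t)).mpr
    ⟨Pi.single t 1, by simp, by rw [comb_single]⟩).2
  rw [monom_add, monom_single] at h1
  have h2 : lam s ≠ 0 := fun h0 => by simpa [h0] using hlam s
  exact mul_left_cancel₀ h2 (by rw [mul_one]; exact h1)

end Resonant

/-! ### Truncating a formal conjugation to a polynomial one. -/

lemma eval_hasFDerivAt {n : ℕ} (Q : MvPolynomial (Fin n) ℂ) (hQ : Q.coeff 0 = 0) :
    HasFDerivAt (fun z : Fin n → ℂ => MvPolynomial.eval z Q)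
      (∑ i, Q.coeff (Finsupp.single i 1) •
        (ContinuousLinearMap.proj i : (Fin n → ℂ) →L[ℂ] ℂ)) 0 := by
  classical
  have h0 : MvPolynomial.eval (0 : Fin n → ℂ) Q = 0 := by
    rw [MvPolynomial.eval_zero, MvPolynomial.constantCoeff_eq, hQ]
  rw [hasFDerivAt_iff_isLittleO_nhds_zero]
  have h1 := eval_isBigO_of_coeff_eq_zero (d := 1)
    (Q - ∑ i, MvPolynomial.C (Q.coeff (Finsupp.single i 1)) * MvPolynomial.X i) fun L hL => by
      rw [MvPolynomial.coeff_sub, MvPolynomial.coeff_sum]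
      simp only [MvPolynomial.coeff_C_mul, MvPolynomial.coeff_X]
      rcases Nat.le_one_iff_eq_zero_or_eq_one.mp hL with h | h
      · rw [Finsupp.degree_eq_zero_iff] at h
        simp [h, hQ]
      · obtain ⟨i, rfl⟩ := (Finsupp.sum_eq_one_iff L).mp (by simpa [Finsupp.sum, Finsupp.degree_apply] using h)
        rw [Finset.sum_eq_single i]
        · simp
        · intro j _ hj
          rw [if_neg, mul_zero]
          exact fun h => hj (Finsupp.single_left_injective one_ne_zero h)
        · simp
  have h2 : (fun z : Fin n → ℂ => ‖z‖ ^ 2) =o[𝓝 0] fun z => z := by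
    have := isLittleO_norm_pow_norm_pow (E' := Fin n → ℂ) (m := 1) (n := 2) (by norm_num)
    simp only [pow_one] at this
    exact this.of_norm_right
  refine (h1.trans_isLittleO h2).congr_left fun z => ?_
  rw [zero_add, h0]
  simp

/-- By the inverse function theorem a truncation of `ψ` is a local change of coordinates. Local
invertibility is recorded only through the image of `𝓝 0` and the bound `z = O(χ z)`. -/
lemma IsFormalChange.exists_polynomial_change {n : ℕ} {ψ : Fin n → MvPowerSeries (Fin n) ℂ}
    (hψ : IsFormalChange ψ) (d : ℕ) :
    ∃ χ : (Fin n → ℂ) → (Fin n → ℂ), Continuous χ ∧ χ 0 = 0 ∧ map χ (𝓝 0) = 𝓝 0 ∧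
      (fun z => z) =O[𝓝 0] χ ∧
      ∀ j, ∃ Q : MvPolynomial (Fin n) ℂ, (∀ z, χ z j = MvPolynomial.eval z Q) ∧
        ∀ L : Fin n →₀ ℕ, L.degree ≤ d → Q.coeff L = MvPowerSeries.coeff L (ψ j) := by
  classical
  -- Truncation at `d + 2` keeps the degrees up to `d + 1`, so the linear part survives even for `d
  -- = 0`.
  set Q : Fin n → MvPolynomial (Fin n) ℂ := fun j => MvPowerSeries.truncTotal (d + 2) (ψ j)
  set χ : (Fin n → ℂ) → (Fin n → ℂ) := fun z j => MvPolynomial.eval z (Q j) with hχ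
  have hcoeff : ∀ j (L : Fin n →₀ ℕ), L.degree ≤ d + 1 →
      (Q j).coeff L = MvPowerSeries.coeff L (ψ j) := fun j L hL =>
    MvPowerSeries.coeff_truncTotal _ (by omega)
  have hQ0 : ∀ j, (Q j).coeff 0 = 0 := fun j => by
    rw [hcoeff j 0 (by simp), MvPowerSeries.coeff_zero_eq_constantCoeff_apply, hψ.constantCoeff]
  have hχ0 : χ 0 = 0 := by
    funext j
    simp only [hχ]
    rw [MvPolynomial.eval_zero, MvPolynomial.constantCoeff_eq, hQ0]
    rfl
  set M : Matrix (Fin n) (Fin n) ℂ := Matrix.of fun i j : Fin n =>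
    MvPowerSeries.coeff (Finsupp.single j 1) (ψ i) with hM
  let e : (Fin n → ℂ) ≃L[ℂ] (Fin n → ℂ) :=
    (Matrix.toLin'OfInv (Matrix.nonsing_inv_mul M hψ.linearPart)
      (Matrix.mul_nonsing_inv M hψ.linearPart)).toContinuousLinearEquiv
  have he : ∀ z, e z = M.mulVec z := fun z => Matrix.toLin'_apply M z
  have hfd : HasFDerivAt χ (e : (Fin n → ℂ) →L[ℂ] (Fin n → ℂ)) 0 := by
    rw [hasFDerivAt_pi']
    intro i
    convert! eval_hasFDerivAt (Q i) (hQ0 i) using 1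
    ext z
    simp only [ContinuousLinearMap.coe_comp, Function.comp_apply, ContinuousLinearMap.proj_apply,
      ContinuousLinearEquiv.coe_coe, he, Matrix.mulVec, dotProduct]
    rw [sum_apply]
    refine Finset.sum_congr rfl fun j _ => ?_
    rw [hcoeff i _ (by simp)]
    rfl
  have han : AnalyticAt ℂ χ 0 := by
    rw [analyticAt_pi_iff]
    exact fun j => AnalyticOnNhd.eval_mvPolynomial (Q j) 0 (Set.mem_univ _)
  have hsfd : HasStrictFDerivAt χ (e : (Fin n → ℂ) →L[ℂ] (Fin n → ℂ)) 0 := by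
    have := han.hasStrictFDerivAt
    rwa [hfd.fderiv] at this
  refine ⟨χ, continuous_pi fun j => MvPolynomial.continuous_eval (Q j), hχ0, ?_, ?_, fun j =>
    ⟨Q j, fun z => rfl, fun L hL => hcoeff j L (by omega)⟩⟩
  · rw [hsfd.map_nhds_eq_of_equiv, hχ0]
  · have h1 : (fun z : Fin n → ℂ => z) =O[𝓝 0] e := by
      simpa using e.isBigO_sub_rev (𝓝 0) (0 : Fin n → ℂ)
    have h2 := hasFDerivAt_iff_isLittleO_nhds_zero.mp hfd
    simp only [zero_add, hχ0, sub_zero] at h2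
    refine h1.trans ((h2.trans_isBigO h1).right_isBigO_add.congr_right fun z => ?_)
    simp

/-- Multi-indices whose entries are at most `d`. -/
def boxIndex (m d : ℕ) : Finset (Fin m → ℕ) := Fintype.piFinset fun _ => Finset.range (d + 1)

lemma mem_boxIndex {m d : ℕ} {K : Fin m → ℕ} : K ∈ boxIndex m d ↔ ∀ t, K t ≤ d := by
  simp [boxIndex]

/-- As `|K| ≤ |K P|`, the box contains every `K` whose term has degree at most `d`. The other terms
of the box have degree above `d` and do no harm, and independence of the `P^t` prevents two `K` from
sharing a monomial. -/
lemma IsPoincareDulac.exists_polynomial {n m : ℕ} {lam : Fin n → ℂ} {P : Fin m → (Fin n →₀ ℕ)}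
    {N : Fin n → MvPowerSeries (Fin n) ℂ} (hN : IsPoincareDulac lam P N)
    (hP : LinearIndependent ℚ (fun t : Fin m => fun j : Fin n => (P t j : ℚ))) (d : ℕ)
    (j : Fin n) :
    ∃ Q : MvPolynomial (Fin n) ℂ,
      (∀ L : Fin n →₀ ℕ, L.degree ≤ d → Q.coeff L = MvPowerSeries.coeff L (N j)) ∧
      ∀ w, MvPolynomial.eval w Q =
        w j * ∑ K ∈ boxIndex m d, resCoeff P N K j * ∏ t, monomMap P w t ^ K t := by
  classical
  refine ⟨∑ K ∈ boxIndex m d, MvPolynomial.monomial (Finsupp.single j 1 + comb P K)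
    (resCoeff P N K j), fun L hL => ?_, fun w => ?_⟩
  · rw [MvPolynomial.coeff_sum]
    simp only [MvPolynomial.coeff_monomial]
    by_cases h : ∃ K, L = Finsupp.single j 1 + comb P K
    · obtain ⟨K, rfl⟩ := h
      have hK : K ∈ boxIndex m d := by
        rw [mem_boxIndex]
        intro t
        have h1 := sum_le_degree_comb hP K
        have h2 := Finset.single_le_sum (f := K) (fun _ _ => Nat.zero_le _) (Finset.mem_univ t)
        rw [map_add] at hL
        omega
      rw [Finset.sum_eq_single K]
      · rw [if_pos rfl]
        rfl
      · intro K' _ hK'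
        rw [if_neg]
        exact fun h => hK' (comb_injective hP (add_left_cancel h))
      · exact fun h => absurd hK h
    · rw [Finset.sum_eq_zero fun K _ => if_neg fun hK => h ⟨K, hK.symm⟩]
      by_contra h0
      rcases hN.resonant j L (Ne.symm h0) with h1 | ⟨K, -, h1⟩
      · exact h ⟨0, by rw [comb_zero, add_zero, h1]⟩
      · exact h ⟨K, h1⟩
  · rw [map_sum, Finset.mul_sum]
    refine Finset.sum_congr rfl fun K _ => ?_
    rw [eval_monomial_eq_monom, monom_add, monom_single, monom_comb]
    ring

/-- A formal conjugation to a Poincaré–Dulac normal form gives polynomial changes of coordinates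
that conjugate `F` to the normal form up to terms of arbitrarily high order. -/
lemma IsNormalFormOf.exists_jet_conjugation {n m : ℕ} {F : (Fin n → ℂ) → (Fin n → ℂ)}
    {lam : Fin n → ℂ} {P : Fin m → (Fin n →₀ ℕ)} {N : Fin n → MvPowerSeries (Fin n) ℂ}
    (hN : IsNormalFormOf F lam P N) (hF : F 0 = 0)
    (hP : LinearIndependent ℚ (fun t : Fin m => fun j : Fin n => (P t j : ℚ))) (d : ℕ) :
    ∃ χ : (Fin n → ℂ) → (Fin n → ℂ), Continuous χ ∧ χ 0 = 0 ∧ map χ (𝓝 0) = 𝓝 0 ∧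
      (fun z => z) =O[𝓝 0] χ ∧
      ∀ j, (fun z => χ (F z) j - χ z j * ∑ K ∈ boxIndex m d,
        resCoeff P N K j * ∏ t, monomMap P (χ z) t ^ K t) =O[𝓝 0] fun z => ‖z‖ ^ (d + 1) := by
  obtain ⟨hPD, T, ψ, hT, hψ, hconj⟩ := hN
  obtain ⟨χ, hχc, hχ0, hχm, hχO, hχQ⟩ := hψ.exists_polynomial_change d
  refine ⟨χ, hχc, hχ0, hχm, hχO, fun j => ?_⟩
  obtain ⟨Q, hQ1, hQ2⟩ := hχQ j
  have h1 : HasTaylor d (fun z => χ (F z) j) (MvPowerSeries.subst T (ψ j)) := by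
    simp only [hQ1]
    exact HasTaylor.eval_subst (fun i => hT.hasTaylor d i) (hT.constantCoeff hF) Q hQ2
  obtain ⟨R, hR1, hR2⟩ := hPD.exists_polynomial hP d j
  have h2 : HasTaylor d (fun z => MvPolynomial.eval (χ z) R) (MvPowerSeries.subst ψ (N j)) := by
    refine HasTaylor.eval_subst (g := fun i z => χ z i) (fun i => ?_) hψ.constantCoeff R hR1
    obtain ⟨Q', hQ'1, hQ'2⟩ := hχQ i
    simp only [hQ'1]
    exact HasTaylor.of_polynomial Q' hQ'2
  rw [hconj j] at h1
  exact (h1.sub_isBigO h2).congr_left fun z => by rw [hR2]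

/-! ### Asymptotics of products. -/

section ProductEstimates

variable {α ι : Type*} {l : Filter α} {g : α → ℝ}

lemma mul_sub_mul_isBigO {a b a' b' : α → ℂ} (h : (fun x => a x - b x) =O[l] g)
    (h' : (fun x => a' x - b' x) =O[l] g) (ha' : a' =O[l] fun _ => (1 : ℝ))
    (hb : b =O[l] fun _ => (1 : ℝ)) : (fun x => a x * a' x - b x * b' x) =O[l] g := by
  have h1 : (fun x => (a x - b x) * a' x) =O[l] g := by simpa using h.mul ha'
  have h2 : (fun x => b x * (a' x - b' x)) =O[l] g := by simpa using hb.mul h'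
  exact (h1.add h2).congr_left fun x => by ring

lemma pow_sub_pow_isBigO {a b : α → ℂ} (h : (fun x => a x - b x) =O[l] g)
    (ha : a =O[l] fun _ => (1 : ℝ)) (hb : b =O[l] fun _ => (1 : ℝ)) (e : ℕ) :
    (fun x => a x ^ e - b x ^ e) =O[l] g := by
  induction e with
  | zero => simpa using isBigO_zero _ _
  | succ e ih =>
    simp only [pow_succ]
    exact mul_sub_mul_isBigO ih h ha (by simpa using hb.pow e)

lemma prod_isBigO_one {a : ι → α → ℂ} (s : Finset ι)
    (ha : ∀ i, a i =O[l] fun _ => (1 : ℝ)) :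
    (fun x => ∏ i ∈ s, a i x) =O[l] fun _ => (1 : ℝ) := by
  simpa using IsBigO.finsetProd (s := s) (f := a) (g := fun _ _ => (1 : ℝ)) fun i _ => ha i

lemma prod_pow_sub_prod_pow_isBigO [Fintype ι] {a b : ι → α → ℂ}
    (h : ∀ i, (fun x => a i x - b i x) =O[l] g) (ha : ∀ i, a i =O[l] fun _ => (1 : ℝ))
    (hb : ∀ i, b i =O[l] fun _ => (1 : ℝ)) (e : ι → ℕ) :
    (fun x => ∏ i, a i x ^ e i - ∏ i, b i x ^ e i) =O[l] g := by
  classical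
  induction (Finset.univ : Finset ι) using Finset.induction_on with
  | empty => simpa using isBigO_zero _ _
  | insert i s hi ih =>
    simp only [Finset.prod_insert hi]
    exact mul_sub_mul_isBigO (pow_sub_pow_isBigO (h i) (ha i) (hb i) _) ih
      (prod_isBigO_one s fun i => by simpa using (ha i).pow (e i))
      (by simpa using (hb i).pow (e i))

/-- `a = 1 + c + o(g)` with `c = O(g)`. -/
structure IsFirstOrder (l : Filter α) (g : α → ℝ) (a c : α → ℂ) : Prop where
  isLittleO : (fun x => a x - (1 + c x)) =o[l] g
  isBigO : c =O[l] g

namespace IsFirstOrder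

variable {a b c c' : α → ℂ}

lemma sub_one_isBigO (h : IsFirstOrder l g a c) : (fun x => a x - 1) =O[l] g :=
  (h.isLittleO.isBigO.add h.isBigO).congr_left fun x => by ring

lemma mul (hg : Tendsto g l (𝓝 0)) (h : IsFirstOrder l g a c) (h' : IsFirstOrder l g b c') :
    IsFirstOrder l g (fun x => a x * b x) (fun x => c x + c' x) := by
  refine ⟨?_, h.isBigO.add h'.isBigO⟩
  have hg1 : g =o[l] fun _ => (1 : ℝ) := (isLittleO_one_iff ℝ).mpr hg
  have h1 : (fun x => (a x - 1) * (b x - 1)) =o[l] g := by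
    simpa using h.sub_one_isBigO.mul_isLittleO (h'.sub_one_isBigO.trans_isLittleO hg1)
  exact ((h.isLittleO.add h'.isLittleO).add h1).congr_left fun x => by ring

lemma one : IsFirstOrder l g (fun _ => 1) (fun _ => 0) :=
  ⟨by simp, isBigO_zero _ _⟩

lemma pow (hg : Tendsto g l (𝓝 0)) (h : IsFirstOrder l g a c) (e : ℕ) :
    IsFirstOrder l g (fun x => a x ^ e) (fun x => e * c x) := by
  induction e with
  | zero => simpa using one
  | succ e ih =>
    have := ih.mul hg h
    simp only [← pow_succ] at this
    convert! this using 2 with x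
    push_cast
    ring

lemma prod_pow [Fintype ι] (hg : Tendsto g l (𝓝 0)) {a c : ι → α → ℂ}
    (h : ∀ i, IsFirstOrder l g (a i) (c i)) (e : ι → ℕ) :
    IsFirstOrder l g (fun x => ∏ i, a i x ^ e i) (fun x => ∑ i, e i * c i x) := by
  classical
  induction (Finset.univ : Finset ι) using Finset.induction_on with
  | empty => simpa using one
  | insert i s hi ih =>
    simp only [Finset.prod_insert hi, Finset.sum_insert hi]
    exact ((h i).pow hg (e i)).mul hg ih

end IsFirstOrder

end ProductEstimates

/-! ### The inverse of a product map, up to a small error. -/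

lemma monom_mul {n : ℕ} (z z' : Fin n → ℂ) (L : Fin n →₀ ℕ) :
    monom (fun j => z j * z' j) L = monom z L * monom z' L := by
  simp [monom, mul_pow, Finset.prod_mul_distrib]

lemma monom_inv {n : ℕ} (z : Fin n → ℂ) (L : Fin n →₀ ℕ) :
    monom (fun j => (z j)⁻¹) L = (monom z L)⁻¹ := by
  simp [monom]

section InverseEstimate

variable {n m : ℕ} {α : Type*} {l : Filter α} {w w' : α → Fin n → ℂ} {ε : α → ℝ}
  {lam : Fin n → ℂ} {P : Fin m → (Fin n →₀ ℕ)} {k : ℕ}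
  {A f : Fin n → (Fin m → ℂ) → ℂ}

lemma coord_isBigO_one (hw : Tendsto w l (𝓝 0)) (j : Fin n) :
    (fun x => w x j) =O[l] fun _ => (1 : ℝ) :=
  ((tendsto_pi_nhds.mp hw) j).isBigO_one ℝ

/-- If `w_j = lam_j w'_j (1 + f_j(u') + O(|u'| ^ (k + 1))) + O(ε)`, where `u' = w' ^ P`, then
`w'_j = lam_j⁻¹ w_j q_j + O(ε)` with `q_j = 1 - f_j(u) + O(|u| ^ (k + 1) + ε)` and `u = w ^ P`. -/
lemma exists_inverse_factor (hw : Tendsto w l (𝓝 0)) (hw' : Tendsto w' l (𝓝 0))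
    (hε : ε =O[l] fun _ => (1 : ℝ)) (hε0 : ∀ x, 0 ≤ ε x) (hk : 1 ≤ k)
    (hlam : ∀ j, ‖lam j‖ = 1) (hPlam : ∀ t, monomMap P lam t = 1)
    (hP0 : monomMap P (0 : Fin n → ℂ) = 0)
    (hA : ∀ j, (fun u => A j u - (1 + f j u)) =O[𝓝 0] fun u => ‖u‖ ^ (k + 1))
    (hf : ∀ j, f j =O[𝓝 0] fun u => ‖u‖ ^ k)
    (hfs : ∀ j, (fun p : (Fin m → ℂ) × (Fin m → ℂ) => f j p.1 - f j p.2) =O[𝓝 (0, 0)]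
      fun p => p.1 - p.2)
    (h : ∀ j, (fun x => w x j - lam j * w' x j * A j (monomMap P (w' x))) =O[l] ε) :
    ∃ q : α → Fin n → ℂ,
      (∀ j, (fun x => w' x j - (lam j)⁻¹ * w x j * q x j) =O[l] ε) ∧
      ∀ j, (fun x => q x j - (1 - f j (monomMap P (w x)))) =O[l]
        fun x => ‖monomMap P (w x)‖ ^ (k + 1) + ε x := by
  have hlam0 : ∀ j, lam j ≠ 0 := fun j h0 => by simpa [h0] using hlam j
  set u : α → Fin m → ℂ := fun x => monomMap P (w x)
  set u' : α → Fin m → ℂ := fun x => monomMap P (w' x)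
  have hu : Tendsto u l (𝓝 0) := by
    have := ((continuous_monomMap P).tendsto 0).comp hw
    rw [hP0] at this
    exact this
  have hu' : Tendsto u' l (𝓝 0) := by
    have := ((continuous_monomMap P).tendsto 0).comp hw'
    rw [hP0] at this
    exact this
  have hun : Tendsto (fun x => ‖u' x‖) l (𝓝 0) := by simpa using hu'.norm
  have hpow : ∀ {a b : ℕ}, b ≤ a → (fun x => ‖u' x‖ ^ a) =O[l] fun x => ‖u' x‖ ^ b := by
    intro a b hab
    refine IsBigO.of_bound 1 ?_
    filter_upwards [hun.eventually_le_const one_pos] with x hx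
    rw [one_mul, Real.norm_of_nonneg (by positivity), Real.norm_of_nonneg (by positivity)]
    exact pow_le_pow_of_le_one (norm_nonneg _) hx hab
  have hAu : ∀ j, (fun x => A j (u' x) - (1 + f j (u' x))) =O[l] fun x => ‖u' x‖ ^ (k + 1) :=
    fun j => (hA j).comp_tendsto hu'
  have hfu : ∀ j, (fun x => f j (u' x)) =O[l] fun x => ‖u' x‖ ^ k :=
    fun j => (hf j).comp_tendsto hu'
  have hA1 : ∀ j, (fun x => A j (u' x) - 1) =O[l] fun x => ‖u' x‖ ^ k := fun j =>
    (((hAu j).trans (hpow (Nat.le_succ k))).add (hfu j)).congr_left fun x => by ring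
  have hpow0 : Tendsto (fun x => ‖u' x‖ ^ k) l (𝓝 0) := by
    simpa [zero_pow (by omega : k ≠ 0)] using hun.pow k
  have hAt : ∀ j, Tendsto (fun x => A j (u' x)) l (𝓝 1) := fun j => by
    have := (hA1 j).trans_tendsto hpow0
    simpa using this.add_const 1
  have hAi : ∀ j, (fun x => (A j (u' x))⁻¹) =O[l] fun _ => (1 : ℝ) := fun j =>
    ((hAt j).inv₀ one_ne_zero).isBigO_one ℝ
  have hAne : ∀ j, ∀ᶠ x in l, A j (u' x) ≠ 0 := fun j => (hAt j).eventually_ne one_ne_zero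
  have hAO : ∀ j, (fun x => A j (u' x)) =O[l] fun _ => (1 : ℝ) := fun j => (hAt j).isBigO_one ℝ
  -- Since `lam ^ P^t = 1`, up to `O(ε)` the monomial `u_t` is `u'_t` times a product of powers of
  -- the `A_j`, which are `1 + O(‖u'‖ ^ k)`.
  have huu : (fun x => u x - u' x) =O[l] fun x => ‖u' x‖ ^ (k + 1) + ε x := by
    rw [isBigO_pi]
    intro t
    have h1 : (fun x => u x t - ∏ j, (lam j * w' x j * A j (u' x)) ^ P t j) =O[l] ε := by
      refine prod_pow_sub_prod_pow_isBigO (a := fun j x => w x j) h (coord_isBigO_one hw)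
        (fun j => ?_) (P t)
      simpa using ((coord_isBigO_one hw' j).const_mul_left (lam j)).mul (hAO j)
    have h2 : ∀ x, ∏ j, (lam j * w' x j * A j (u' x)) ^ P t j =
        u' x t * ∏ j, A j (u' x) ^ P t j := fun x => by
      have := monom_mul (fun j => lam j * w' x j) (fun j => A j (u' x)) (P t)
      rw [monom_mul lam (w' x)] at this
      rw [show monom lam (P t) = 1 from hPlam t, one_mul] at this
      exact this
    have h3 : (fun x => ∏ j, A j (u' x) ^ P t j - ∏ j : Fin n, (1 : ℂ) ^ P t j) =O[l]
        fun x => ‖u' x‖ ^ k :=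
      prod_pow_sub_prod_pow_isBigO (b := fun _ _ => 1) hA1 hAO
        (fun j => (isBigO_refl _ _).trans (isBigO_const_const _ one_ne_zero _)) (P t)
    have h4 : (fun x => u' x t) =O[l] fun x => ‖u' x‖ :=
      IsBigO.of_norm_le fun x => norm_le_pi_norm (u' x) t
    have h5 := h4.mul h3
    have h6 : (fun x => ‖u' x‖ * ‖u' x‖ ^ k) =O[l] fun x => ‖u' x‖ ^ (k + 1) + ε x :=
      IsBigO.of_norm_le fun x => by
        rw [Real.norm_of_nonneg (by positivity), ← pow_succ']
        exact le_add_of_nonneg_right (hε0 x)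
    have h7 : ε =O[l] fun x => ‖u' x‖ ^ (k + 1) + ε x :=
      IsBigO.of_norm_le fun x => by
        rw [Real.norm_of_nonneg (hε0 x)]
        exact le_add_of_nonneg_left (by positivity)
    refine ((h1.trans h7).add (h5.trans h6)).congr_left fun x => ?_
    rw [h2]
    simp
    ring
  have hu'u : (fun x => ‖u' x‖) =O[l] fun x => ‖u x‖ + ε x := by
    obtain ⟨C, hC, hb⟩ := huu.exists_pos
    refine IsBigO.of_bound (2 * (1 + C)) ?_
    -- Near the limit the term `C ‖u'‖ ^ (k + 1)` is at most `‖u'‖ / 2` and is absorbed on the left.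
    have h8 : ∀ᶠ x in l, C * ‖u' x‖ ^ k ≤ 1 / 2 := by
      have := hpow0.const_mul C
      rw [mul_zero] at this
      exact this.eventually_le_const (by norm_num)
    filter_upwards [hb.bound, h8] with x hx hx2
    have h9 : ‖u' x‖ ≤ ‖u x‖ + ‖u x - u' x‖ := by
      have := norm_sub_le (u x) (u x - u' x)
      rwa [sub_sub_cancel] at this
    rw [Real.norm_of_nonneg (by have := hε0 x; positivity), pow_succ] at hx
    rw [norm_norm, Real.norm_of_nonneg (by have := hε0 x; positivity)]
    nlinarith [norm_nonneg (u' x), norm_nonneg (u x), hε0 x, mul_nonneg hC.le (hε0 x),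
      mul_nonneg hC.le (norm_nonneg (u x)), mul_le_mul_of_nonneg_right hx2 (norm_nonneg (u' x))]
  have hu'pow : (fun x => ‖u' x‖ ^ (k + 1)) =O[l] fun x => ‖u x‖ ^ (k + 1) + ε x := by
    refine (hu'u.pow (k + 1)).trans ?_
    have h10 : (fun x => ε x ^ (k + 1)) =O[l] ε := by
      have := (isBigO_refl ε l).mul (hε.pow k)
      simpa [pow_succ'] using this
    have h11 : (fun x => (‖u x‖ + ε x) ^ (k + 1)) =O[l]
        fun x => ‖u x‖ ^ (k + 1) + ε x ^ (k + 1) := by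
      refine IsBigO.of_bound (2 ^ k) (Eventually.of_forall fun x => ?_)
      have := hε0 x
      rw [Real.norm_of_nonneg (by positivity), Real.norm_of_nonneg (by positivity)]
      simpa using add_pow_le (norm_nonneg (u x)) this (k + 1)
    refine h11.trans (IsBigO.add ?_ (h10.trans ?_))
    · exact IsBigO.of_norm_le fun x => by
        rw [Real.norm_of_nonneg (by positivity)]
        exact le_add_of_nonneg_right (hε0 x)
    · exact IsBigO.of_norm_le fun x => by
        rw [Real.norm_of_nonneg (hε0 x)]
        exact le_add_of_nonneg_left (by positivity)
  have huε : (fun x => ‖u' x‖ ^ (k + 1) + ε x) =O[l] fun x => ‖u x‖ ^ (k + 1) + ε x := by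
    refine hu'pow.add (IsBigO.of_norm_le fun x => ?_)
    rw [Real.norm_of_nonneg (hε0 x)]
    exact le_add_of_nonneg_left (by positivity)
  refine ⟨fun x j => (A j (u' x))⁻¹, fun j => ?_, fun j => ?_⟩
  · have h12 := ((h j).mul (hAi j)).const_mul_left (-(lam j)⁻¹)
    simp only [mul_one] at h12
    refine h12.congr' ?_ EventuallyEq.rfl
    filter_upwards [hAne j] with x hx
    have := hlam0 j
    field_simp
    ring
  -- Decomposition: `1 / A - (1 - f(u)) = (A - 1)² / A - (A - 1 - f(u')) + (f(u) - f(u'))`. The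
  -- first term has order `2 k ≥ k + 1`.
  · have h13 : (fun x => (A j (u' x) - 1) * (A j (u' x) - 1) * (A j (u' x))⁻¹) =O[l]
        fun x => ‖u' x‖ ^ (k + 1) := by
      have := ((hA1 j).mul (hA1 j)).mul (hAi j)
      simp only [mul_one, ← pow_add] at this
      exact this.trans (hpow (by omega))
    have h14 : (fun x => f j (u x) - f j (u' x)) =O[l] fun x => u x - u' x :=
      (hfs j).comp_tendsto (by rw [nhds_prod_eq]; exact hu.prodMk hu')
    have h15 := (h13.sub (hAu j)).trans hu'pow
    refine (h15.add ((h14.trans huu).trans huε)).congr' ?_ EventuallyEq.rfl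
    filter_upwards [hAne j] with x hx
    field_simp
    ring

end InverseEstimate

/-! ### Time slices and one step of the dynamics. -/

/-- The homogeneous vector field `u_t ∑_j P^t_j f_j(u)` induced on the shadow by the factors
`f_j`. -/
def shadowField {n m : ℕ} (P : Fin m → (Fin n →₀ ℕ)) (f : Fin n → (Fin m → ℂ) → ℂ)
    (u : Fin m → ℂ) : Fin m → ℂ :=
  fun t => u t * ∑ j, (P t j : ℂ) * f j u

/-- The shadow variable `u` at time `t`, in units of the parabolic solution `σ t ^ (-1 / k)`. -/
def rescaled {m : ℕ} (k : ℕ) (σ : ℂ) (t : ℝ) (u : Fin m → ℂ) : Fin m → ℂ :=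
  (((t ^ ((k : ℝ)⁻¹) : ℝ) : ℂ) * σ⁻¹) • u

/-- The points which at time `t` shadow the parabolic solution `σ t ^ (-1 / k) v`. -/
def timeSlice {n m : ℕ} (P : Fin m → (Fin n →₀ ℕ)) (p : Seminorm ℂ (Fin m → ℂ)) (v : Fin m → ℂ)
    (k : ℕ) (σ : ℂ) (η β t : ℝ) : Set (Fin n → ℂ) :=
  {w | p (rescaled k σ t (monomMap P w) - v) < η ∧ ∀ j, ‖w j‖ < t ^ (-β)}

lemma norm_one_add_le_re (a : ℂ) : ‖1 + a‖ ≤ 1 + a.re + ‖a‖ ^ 2 := by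
  have h : ‖1 + a‖ ^ 2 = 1 + 2 * a.re + ‖a‖ ^ 2 := by
    rw [← Complex.normSq_eq_norm_sq, ← Complex.normSq_eq_norm_sq, Complex.normSq_apply,
      Complex.normSq_apply]
    simp
    ring
  nlinarith [sq_nonneg (‖1 + a‖ - 1), sq_nonneg ‖a‖]

/-- The coordinate bound `t ^ (-β)` of a slice shrinks in one step by no more than the factor `1 - β
/ t`, so contracting `w_j` slightly more than this is enough. -/
lemma rpow_neg_mul_one_sub_le {t β : ℝ} (ht : 0 < t) (hβ : 0 ≤ β) :
    t ^ (-β) * (1 - β * t⁻¹) ≤ (t + 1) ^ (-β) := by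
  have h1 : t + 1 = t * (1 + t⁻¹) := by field_simp
  rw [h1, Real.mul_rpow ht.le (by positivity)]
  refine mul_le_mul_of_nonneg_left ?_ (by positivity)
  have h2 : Real.log (1 + t⁻¹) ≤ t⁻¹ := by
    have := Real.log_le_sub_one_of_pos (show 0 < 1 + t⁻¹ by positivity)
    linarith
  rw [Real.rpow_def_of_pos (by positivity)]
  have h3 := Real.add_one_le_exp (Real.log (1 + t⁻¹) * -β)
  nlinarith

section Step

variable {α : Type*} {L : Filter α} {t : α → ℝ}

lemma isFirstOrder_rpow_ratio (ht : Tendsto t L atTop) (κ : ℝ) :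
    IsFirstOrder L (fun x => (t x)⁻¹)
      (fun x => (((t x + 1) ^ κ * (t x) ^ (-κ) : ℝ) : ℂ)) (fun x => (κ * (t x)⁻¹ : ℝ)) := by
  have hinv : Tendsto (fun x => (t x)⁻¹) L (𝓝 0) := tendsto_inv_atTop_zero.comp ht
  have hd : HasDerivAt (fun s : ℝ => (1 + s) ^ κ) κ 0 := by
    have h1 : HasDerivAt (fun s : ℝ => 1 + s) 1 0 := (hasDerivAt_id 0).const_add 1
    simpa using h1.rpow_const (p := κ) (Or.inl (by norm_num))
  have hlo := (hasDerivAt_iff_isLittleO_nhds_zero.mp hd).comp_tendsto hinv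
  refine ⟨?_, ?_⟩
  · refine IsLittleO.of_norm_left ((hlo.norm_left).congr' ?_ EventuallyEq.rfl)
    filter_upwards [ht.eventually_gt_atTop 0] with x hx
    have h2 : (t x + 1) ^ κ * (t x) ^ (-κ) = (1 + (t x)⁻¹) ^ κ := by
      rw [Real.rpow_neg hx.le, ← Real.inv_rpow hx.le,
        ← Real.mul_rpow (by positivity) (by positivity)]
      congr 1
      field_simp
    rw [h2]
    simp only [Function.comp_apply, zero_add, add_zero, Real.one_rpow, smul_eq_mul]
    rw [← Complex.ofReal_one, ← Complex.ofReal_add, ← Complex.ofReal_sub, Complex.norm_real]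
    congr 1
    ring
  · refine IsBigO.of_norm_left ?_
    simp only [Complex.norm_real]
    exact ((isBigO_refl _ L).const_mul_left κ).norm_left

variable {n m : ℕ} {P : Fin m → (Fin n →₀ ℕ)} {f : Fin n → (Fin m → ℂ) → ℂ} {k : ℕ}
  {lam : Fin n → ℂ} {σ : ℂ} {v : Fin m → ℂ} {p : Seminorm ℂ (Fin m → ℂ)} {η β : ℝ}
  {w w' q : α → Fin n → ℂ}

lemma eq_smul_rescaled {k : ℕ} {σ : ℂ} (hσ : σ ≠ 0) {t : ℝ} (ht : 0 < t) (u : Fin m → ℂ) :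
    u = (σ * ((t ^ (-(k : ℝ)⁻¹) : ℝ) : ℂ)) • rescaled k σ t u := by
  rw [rescaled, smul_smul, Real.rpow_neg ht.le]
  have : ((t ^ ((k : ℝ)⁻¹) : ℝ) : ℂ) ≠ 0 := by exact_mod_cast (Real.rpow_pos_of_pos ht _).ne'
  rw [Complex.ofReal_inv]
  generalize ((t ^ ((k : ℝ)⁻¹) : ℝ) : ℂ) = T at this ⊢
  rw [show σ * T⁻¹ * (T * σ⁻¹) = 1 by field_simp, one_smul]

lemma pow_scale (hk : 1 ≤ k) (hσ : σ ^ k = -1) {t : ℝ} (ht : 0 < t) :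
    (σ * ((t ^ (-(k : ℝ)⁻¹) : ℝ) : ℂ)) ^ k = -((t⁻¹ : ℝ) : ℂ) := by
  rw [mul_pow, hσ, ← Complex.ofReal_pow, Real.rpow_neg ht.le, inv_pow,
    Real.rpow_inv_natCast_pow ht.le (by omega)]
  ring

/-- The time-`t` slice is mapped into the time-`(t + 1)` slice, for large `t`. -/
lemma eventually_mem_timeSlice (ht : Tendsto t L atTop) (hk : 1 ≤ k) (hσ : σ ^ k = -1)
    (hfh : ∀ j (c : ℂ) u, f j (c • u) = c ^ k * f j u) (hfc : ∀ j, Continuous (f j))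
    (hlam : ∀ j, ‖lam j‖ = 1) (hPlam : ∀ t, monomMap P lam t = 1)
    (hp : ∀ y, ‖y‖ ≤ p y) {C : ℝ} (hC : ∀ y, p y ≤ C * ‖y‖)
    {A : (Fin m → ℂ) →L[ℂ] (Fin m → ℂ)} {c s₀ : ℝ} (hc : 0 < c) (hs₀ : 0 < s₀)
    (hA : ∀ s : ℝ, 0 ≤ s → s ≤ s₀ → ∀ y, p (y - (s : ℂ) • A y) ≤ (1 - c * s) * p y)
    (hη : 0 < η) (hβ : 0 < β)
    (hre : ∀ y, p y < η → ∀ j, (f j (v + y)).re ≤ -(2 * β))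
    (hrem : ∀ y, p y < η → p ((k : ℂ)⁻¹ • (v + y) + shadowField P f (v + y) + A y) ≤ c / 2 * p y)
    (hw : ∀ᶠ x in L, w x ∈ timeSlice P p v k σ η β (t x))
    (hw' : ∀ j, (fun x => w' x j - (lam j)⁻¹ * w x j * q x j) =o[L]
      fun x => t x ^ (-(1 + β + (k : ℝ)⁻¹)))
    (hq : ∀ j, (fun x => q x j - (1 - f j (monomMap P (w x)))) =o[L] fun x => (t x)⁻¹) :
    ∀ᶠ x in L, w' x ∈ timeSlice P p v k σ η β (t x + 1) := by
  have hσ0 : σ ≠ 0 := by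
    rintro rfl
    rw [zero_pow (by omega)] at hσ
    norm_num at hσ
  have hσn : ‖σ‖ = 1 := by
    have h1 : ‖σ‖ ^ k = 1 := by rw [← norm_pow, hσ]; simp
    exact (pow_eq_one_iff_of_nonneg (norm_nonneg _) (by omega)).mp h1
  set κ : ℝ := (k : ℝ)⁻¹ with hκ
  have hκ0 : 0 ≤ κ := by positivity
  have ht0 : ∀ᶠ x in L, 0 < t x := ht.eventually_gt_atTop 0
  have hinv : Tendsto (fun x => (t x)⁻¹) L (𝓝 0) := tendsto_inv_atTop_zero.comp ht
  have hinv1 : (fun x => (t x)⁻¹) =o[L] fun _ => (1 : ℝ) := (isLittleO_one_iff ℝ).mpr hinv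
  set u : α → Fin m → ℂ := fun x => monomMap P (w x) with hu
  set y : α → Fin m → ℂ := fun x => rescaled k σ (t x) (u x) - v with hy
  have hvy : ∀ x, v + y x = rescaled k σ (t x) (u x) := fun x => by simp [hy]
  have hpy : ∀ᶠ x in L, p (y x) < η := hw.mono fun x hx => hx.1
  have hwt : ∀ᶠ x in L, ∀ j, ‖w x j‖ < t x ^ (-β) := hw.mono fun x hx => hx.2
  -- The phase enters here: `σ ^ k = -1` reverses the sign of `f_j`, so that `1 - f_j(u)` becomes `1
  -- + f_j(v + y) / t`.
  have hφ : ∀ᶠ x in L, ∀ j, f j (u x) = -(((t x)⁻¹ : ℝ) : ℂ) * f j (v + y x) := by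
    filter_upwards [ht0] with x hx j
    rw [hvy]
    conv_lhs => rw [eq_smul_rescaled (k := k) hσ0 hx (u x), hfh, pow_scale hk hσ hx]
  have hφO : ∀ j, (fun x => f j (v + y x)) =O[L] fun _ => (1 : ℝ) := fun j => by
    obtain ⟨B, hB⟩ := (isCompact_closedBall v η).exists_bound_of_continuousOn (hfc j).continuousOn
    refine IsBigO.of_bound B ?_
    filter_upwards [hpy] with x hx
    have : v + y x ∈ Metric.closedBall v η := by
      simpa using (hp (y x)).trans hx.le
    simpa using hB _ this
  have hvyO : ∀ τ, (fun x => (v + y x) τ) =O[L] fun _ => (1 : ℝ) := fun τ => by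
    refine IsBigO.of_bound (‖v‖ + η) ?_
    filter_upwards [hpy] with x hx
    have h1 : ‖(v + y x) τ‖ ≤ ‖v + y x‖ := norm_le_pi_norm (v + y x) τ
    have h2 := norm_add_le v (y x)
    have h3 := hp (y x)
    rw [norm_one, mul_one]
    linarith
  have hqF : ∀ j, IsFirstOrder L (fun x => (t x)⁻¹) (fun x => q x j)
      (fun x => (((t x)⁻¹ : ℝ) : ℂ) * f j (v + y x)) := fun j => by
    refine ⟨(hq j).congr' ?_ EventuallyEq.rfl, ?_⟩
    · filter_upwards [hφ] with x hx
      rw [hx j]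
      ring
    · have h1 : (fun x => (((t x)⁻¹ : ℝ) : ℂ)) =O[L] fun x => (t x)⁻¹ :=
        IsBigO.of_bound 1 (Eventually.of_forall fun x => by rw [Complex.norm_real, one_mul])
      simpa using h1.mul (hφO j)
  have hqO : ∀ j, (fun x => q x j) =O[L] fun _ => (1 : ℝ) := fun j => by
    have := ((hqF j).sub_one_isBigO.trans hinv1.isBigO).add (isBigO_refl (fun _ => (1 : ℂ)) L
      |>.trans (isBigO_const_const _ one_ne_zero _))
    exact this.congr_left fun x => by ring
  have hlami : ∀ j, ‖(lam j)⁻¹‖ = 1 := fun j => by rw [norm_inv, hlam, inv_one]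
  -- From `Re f_j ≤ -2β`, two errors of size `β / (4 t)` leave `‖q_j‖ ≤ 1 - (3/2) β / t`. This beats
  -- the factor `1 - β / t`, with room for one more such error.
  have hwj : ∀ j, ∀ᶠ x in L, ‖w' x j‖ < (t x + 1) ^ (-β) := fun j => by
    have h1 : (fun x => ‖q x j - 1‖ ^ 2) =o[L] fun x => (t x)⁻¹ := by
      have := (hqF j).sub_one_isBigO.mul_isLittleO
        ((hqF j).sub_one_isBigO.trans_isLittleO hinv1)
      simp only [mul_one] at this
      refine this.norm_left.congr_left fun x => ?_
      rw [norm_mul, sq]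
    have h2 : (fun x => t x ^ (-(1 + β + κ))) =O[L] fun x => t x ^ (-β) * (t x)⁻¹ := by
      refine IsBigO.of_bound 1 ?_
      filter_upwards [ht.eventually_ge_atTop 1] with x hx
      have hx0 : 0 < t x := by linarith
      rw [one_mul, Real.norm_of_nonneg (by positivity), Real.norm_of_nonneg (by positivity),
        ← Real.rpow_neg_one, ← Real.rpow_add hx0]
      exact Real.rpow_le_rpow_of_exponent_le hx (by linarith)
    have h3 := (hw' j).trans_isBigO h2
    filter_upwards [ht0, hpy, hwt, h1.bound (show 0 < β / 4 by positivity),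
      (hqF j).isLittleO.bound (show 0 < β / 4 by positivity),
      h3.bound (show 0 < β / 4 by positivity)] with x hx0 hxy hxw e1 e2 e3
    have hi : 0 < (t x)⁻¹ := by positivity
    have hb : 0 < t x ^ (-β) := by positivity
    rw [Real.norm_of_nonneg (by positivity), Real.norm_of_nonneg hi.le] at e1
    rw [Real.norm_of_nonneg hi.le] at e2
    rw [Real.norm_of_nonneg (by positivity)] at e3
    have e4 : (q x j - 1).re ≤ -(2 * β) * (t x)⁻¹ + β / 4 * (t x)⁻¹ := by
      have h4 := (Complex.re_le_norm _).trans e2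
      have h5 := mul_le_mul_of_nonneg_left (hre _ hxy j) hi.le
      simp only [Complex.sub_re, Complex.add_re, Complex.one_re, Complex.re_ofReal_mul] at h4 ⊢
      linarith
    have e5 : ‖q x j‖ ≤ 1 - (3 / 2) * β * (t x)⁻¹ := by
      have h4 := norm_one_add_le_re (q x j - 1)
      rw [add_sub_cancel] at h4
      linarith
    have e6 : ‖w' x j‖ ≤ ‖w x j‖ * ‖q x j‖ + β / 4 * (t x ^ (-β) * (t x)⁻¹) := by
      have h4 := norm_add_le (w' x j - (lam j)⁻¹ * w x j * q x j) ((lam j)⁻¹ * w x j * q x j)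
      rw [sub_add_cancel, norm_mul ((lam j)⁻¹ * w x j), norm_mul, hlami, one_mul] at h4
      linarith
    have e7 := rpow_neg_mul_one_sub_le hx0 hβ.le
    have e8 : ‖w x j‖ * ‖q x j‖ ≤ t x ^ (-β) * (1 - (3 / 2) * β * (t x)⁻¹) :=
      mul_le_mul (hxw j).le e5 (norm_nonneg _) hb.le
    have e9 : 0 < β * (t x ^ (-β) * (t x)⁻¹) := by positivity
    linarith
  have hwO : ∀ j, (fun x => w x j) =O[L] fun _ => (1 : ℝ) := fun j => by
    refine IsBigO.of_bound 1 ?_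
    filter_upwards [hwt, ht.eventually_ge_atTop 1] with x hx hx1
    rw [norm_one, mul_one]
    exact (hx j).le.trans (Real.rpow_le_one_of_one_le_of_nonpos hx1 (by linarith))
  have hw'O : ∀ j, (fun x => w' x j) =O[L] fun _ => (1 : ℝ) := fun j => by
    refine IsBigO.of_bound 1 ?_
    filter_upwards [hwj j, ht.eventually_ge_atTop 1] with x hx hx1
    rw [norm_one, mul_one]
    exact hx.le.trans (Real.rpow_le_one_of_one_le_of_nonpos (by linarith) (by linarith))
  set y' : α → Fin m → ℂ := fun x => rescaled k σ (t x + 1) (monomMap P (w' x)) - v with hy'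
  -- The factors `(lam j)⁻¹` drop out of the monomials because `lam ^ P^t = 1`.
  have hprod : ∀ τ, (fun x => monomMap P (w' x) τ - u x τ * ∏ j, q x j ^ P τ j) =o[L]
      fun x => t x ^ (-(1 + β + κ)) := fun τ => by
    have h1 : (fun x => ∑ j, ‖w' x j - (lam j)⁻¹ * w x j * q x j‖) =o[L]
        fun x => t x ^ (-(1 + β + κ)) :=
      IsLittleO.fun_sum fun j _ => (hw' j).norm_left
    have h2 := prod_pow_sub_prod_pow_isBigO (l := L) (a := fun j x => w' x j)
      (b := fun j x => (lam j)⁻¹ * w x j * q x j)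
      (g := fun x => ∑ j, ‖w' x j - (lam j)⁻¹ * w x j * q x j‖)
      (fun j => IsBigO.of_norm_le fun x => Finset.single_le_sum
        (f := fun j => ‖w' x j - (lam j)⁻¹ * w x j * q x j‖)
        (fun _ _ => norm_nonneg _) (Finset.mem_univ j)) hw'O
      (fun j => by simpa using ((hwO j).const_mul_left (lam j)⁻¹).mul (hqO j)) (P τ)
    refine (h2.trans_isLittleO h1).congr_left fun x => ?_
    have h3 := monom_mul (fun j => (lam j)⁻¹ * w x j) (fun j => q x j) (P τ)
    rw [monom_mul (fun j => (lam j)⁻¹) (w x), monom_inv,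
      show monom lam (P τ) = 1 from hPlam τ, inv_one, one_mul] at h3
    simp only [monomMap, hu]
    rw [show ∏ j, q x j ^ P τ j = monom (fun j => q x j) (P τ) from rfl, ← h3]
    rfl
  -- In the rescaled variable one iteration is an Euler step of length `1 / t`: the ratio `((t + 1)
  -- / t) ^ (1 / k)` contributes `(v + y) / k` and the factors `q_j` contribute the shadow field at
  -- `v + y`. The term `A y` is subtracted and added to isolate the linear part.
  have hstep : (fun x => y' x - (y x - (((t x)⁻¹ : ℝ) : ℂ) • A (y x) +
      (((t x)⁻¹ : ℝ) : ℂ) • ((k : ℂ)⁻¹ • (v + y x) + shadowField P f (v + y x) + A (y x))))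
      =o[L] fun x => (t x)⁻¹ := by
    rw [isLittleO_pi]
    intro τ
    have h1 := (isFirstOrder_rpow_ratio ht κ).mul hinv
      (IsFirstOrder.prod_pow hinv hqF (P τ))
    have h2 := (hvyO τ).mul_isLittleO h1.isLittleO
    simp only [one_mul] at h2
    have h3 : (fun x => (((t x + 1) ^ κ : ℝ) : ℂ) * σ⁻¹) =O[L] fun x => t x ^ κ := by
      refine IsBigO.of_bound (2 ^ κ) ?_
      filter_upwards [ht.eventually_ge_atTop 1] with x hx
      have hx0 : 0 < t x := by linarith
      rw [norm_mul, norm_inv, hσn, inv_one, mul_one, Complex.norm_real,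
        Real.norm_of_nonneg (by positivity), Real.norm_of_nonneg (by positivity),
        ← Real.mul_rpow (by norm_num) hx0.le]
      exact Real.rpow_le_rpow (by positivity) (by linarith) hκ0
    have h4 := h3.mul_isLittleO (hprod τ)
    have h5 : (fun x => t x ^ κ * t x ^ (-(1 + β + κ))) =O[L] fun x => (t x)⁻¹ := by
      refine IsBigO.of_bound 1 ?_
      filter_upwards [ht.eventually_ge_atTop 1] with x hx
      have hx0 : 0 < t x := by linarith
      rw [one_mul, Real.norm_of_nonneg (by positivity), Real.norm_of_nonneg (by positivity),
        ← Real.rpow_neg_one, ← Real.rpow_add hx0]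
      exact Real.rpow_le_rpow_of_exponent_le hx (by linarith)
    refine ((h4.trans_isBigO h5).add h2).congr' ?_ EventuallyEq.rfl
    filter_upwards [ht0] with x hx
    have h6 : u x τ = σ * ((t x ^ (-κ) : ℝ) : ℂ) * (v + y x) τ := by
      conv_lhs => rw [eq_smul_rescaled (k := k) hσ0 hx (u x), ← hvy]
      rfl
    have h7 : y' x τ = (((t x + 1) ^ κ : ℝ) : ℂ) * σ⁻¹ * monomMap P (w' x) τ - v τ := rfl
    have h8 : ∑ j, (P τ j : ℂ) * ((((t x)⁻¹ : ℝ) : ℂ) * f j (v + y x)) =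
        (((t x)⁻¹ : ℝ) : ℂ) * ∑ j, (P τ j : ℂ) * f j (v + y x) := by
      rw [Finset.mul_sum]
      exact Finset.sum_congr rfl fun j _ => by ring
    have h9 : (κ : ℂ) = (k : ℂ)⁻¹ := by simp [hκ]
    simp only [Pi.sub_apply, Pi.add_apply, Pi.smul_apply, smul_eq_mul, shadowField]
    rw [h7, h6, h8]
    simp only [Pi.add_apply]
    push_cast
    rw [← h9]
    field_simp
    ring
  -- With `s = 1 / t`, the linear part gains `c s p(y)`, the nonlinear remainder gives back at most
  -- half of it, and the error `e` costs at most `c s η / 4`. This leaves `p (y') < η`.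
  have hyη : ∀ᶠ x in L, p (y' x) < η := by
    have hC0 : 0 < |C| + 1 := by positivity
    filter_upwards [ht0, hpy, hinv.eventually_le_const hs₀,
      hinv.eventually_le_const (show 0 < 1 / c by positivity),
      hstep.bound (show 0 < c * η / (4 * (|C| + 1)) by positivity)] with x hx hxy hxs hxc hxe
    set s : ℝ := (t x)⁻¹ with hs
    have hs0 : 0 < s := by positivity
    set r := (k : ℂ)⁻¹ • (v + y x) + shadowField P f (v + y x) + A (y x)
    set e := y' x - (y x - (s : ℂ) • A (y x) + (s : ℂ) • r)
    have e1 : y' x = e + (y x - (s : ℂ) • A (y x) + (s : ℂ) • r) := by simp [e]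
    have e2 : p e ≤ c * η / 4 * s := by
      refine (hC e).trans ?_
      rw [Real.norm_of_nonneg hs0.le] at hxe
      calc C * ‖e‖ ≤ (|C| + 1) * (c * η / (4 * (|C| + 1)) * s) := by
            refine mul_le_mul ?_ hxe (norm_nonneg _) hC0.le
            linarith [le_abs_self C]
        _ = _ := by field_simp
    have e3 : p ((s : ℂ) • r) ≤ s * (c / 2 * p (y x)) := by
      rw [map_smul_eq_mul, Complex.norm_real, Real.norm_of_nonneg hs0.le]
      exact mul_le_mul_of_nonneg_left (hrem _ hxy) hs0.le
    have e4 := hA s hs0.le hxs (y x)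
    have e5 : p (y' x) ≤ p e + (p (y x - (s : ℂ) • A (y x)) + p ((s : ℂ) • r)) := by
      rw [e1]
      exact (map_add_le_add p _ _).trans (add_le_add_right (map_add_le_add p _ _) _)
    have e6 : c * s ≤ 1 := by
      have := mul_le_mul_of_nonneg_left hxc hc.le
      rwa [mul_one_div_cancel hc.ne'] at this
    have e7 : (1 - c * s / 2) * p (y x) ≤ (1 - c * s / 2) * η :=
      mul_le_mul_of_nonneg_left hxy.le (by linarith)
    have e8 : 0 < c * s * η := by positivity
    nlinarith
  filter_upwards [hyη, eventually_all.mpr hwj] with x hx1 hx2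
  exact ⟨hx1, hx2⟩

end Step

/-! ### Leading terms of the normal form. -/

lemma IsOrderOfNormalForm.one_le {n m : ℕ} {P : Fin m → (Fin n →₀ ℕ)}
    {N : Fin n → MvPowerSeries (Fin n) ℂ} {k : ℕ} (hk : IsOrderOfNormalForm P N k) : 1 ≤ k := by
  obtain ⟨K, s, hK, hsum, -⟩ := hk.1
  obtain ⟨t, ht⟩ := Function.ne_iff.mp hK
  have := Finset.single_le_sum (f := K) (fun _ _ => Nat.zero_le _) (Finset.mem_univ t)
  simp only [Pi.zero_apply] at ht
  omega

section FiberTerm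

variable {n m : ℕ} {lam : Fin n → ℂ} {P : Fin m → (Fin n →₀ ℕ)}
  {N : Fin n → MvPowerSeries (Fin n) ℂ} {k : ℕ}

lemma shadowH_eq_shadowField :
    shadowH lam P N k = shadowField P (fiberTerm lam P N k) := by
  funext u t
  simp only [shadowH, shadowField, fiberTerm, Finset.mul_sum, Finset.sum_mul]
  rw [Finset.sum_comm]
  refine Finset.sum_congr rfl fun j _ => Finset.sum_congr rfl fun K _ => ?_
  ring

lemma fiberTerm_smul (j : Fin n) (c : ℂ) (u : Fin m → ℂ) :
    fiberTerm lam P N k j (c • u) = c ^ k * fiberTerm lam P N k j u := by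
  simp only [fiberTerm, Finset.mul_sum]
  refine Finset.sum_congr rfl fun K hK => ?_
  have hK : ∑ t, K t = k := (Finset.mem_piAntidiag.mp hK).1
  simp only [Pi.smul_apply, smul_eq_mul, mul_pow, Finset.prod_mul_distrib,
    Finset.prod_pow_eq_pow_sum, hK]
  ring

lemma shadowField_smul {f : Fin n → (Fin m → ℂ) → ℂ}
    (hf : ∀ j (c : ℂ) u, f j (c • u) = c ^ k * f j u) (c : ℂ) (u : Fin m → ℂ) :
    shadowField P f (c • u) = c ^ (k + 1) • shadowField P f u := by
  funext t
  simp only [shadowField, Pi.smul_apply, smul_eq_mul, hf, Finset.mul_sum]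
  refine Finset.sum_congr rfl fun j _ => ?_
  ring

lemma contDiff_fiberTerm (j : Fin n) : ContDiff ℂ 1 (fiberTerm lam P N k j) := by
  unfold fiberTerm
  refine ContDiff.sum fun K _ => contDiff_const.mul (contDiff_prod fun t _ => ?_)
  exact (contDiff_apply ℂ ℂ t).pow _

lemma differentiable_shadowField {f : Fin n → (Fin m → ℂ) → ℂ}
    (hf : ∀ j, Differentiable ℂ (f j)) : Differentiable ℂ (shadowField P f) := by
  unfold shadowField
  fun_prop

lemma norm_prod_pow_le (u : Fin m → ℂ) (K : Fin m → ℕ) :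
    ‖∏ t, u t ^ K t‖ ≤ ‖u‖ ^ ∑ t, K t := by
  rw [norm_prod, ← Finset.prod_pow_eq_pow_sum]
  refine Finset.prod_le_prod (fun _ _ => norm_nonneg _) fun t _ => ?_
  rw [norm_pow]
  exact pow_le_pow_left₀ (norm_nonneg _) (norm_le_pi_norm u t) _

lemma prod_pow_isBigO {K : Fin m → ℕ} {e : ℕ} (hK : e ≤ ∑ t, K t) :
    (fun u : Fin m → ℂ => ∏ t, u t ^ K t) =O[𝓝 0] fun u => ‖u‖ ^ e := by
  refine IsBigO.of_bound 1 ?_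
  filter_upwards [eventually_norm_le_one] with u hu
  rw [one_mul, Real.norm_of_nonneg (by positivity)]
  exact (norm_prod_pow_le u K).trans (pow_le_pow_of_le_one (norm_nonneg _) hu hK)

lemma fiberTerm_isBigO (j : Fin n) :
    fiberTerm lam P N k j =O[𝓝 0] fun u => ‖u‖ ^ k := by
  have := IsBigO.sum (l := 𝓝 (0 : Fin m → ℂ)) (g := fun u : Fin m → ℂ => ‖u‖ ^ k)
    (s := Finset.piAntidiag (Finset.univ : Finset (Fin m)) k)
    (A := fun K u => resCoeff P N K j / lam j * ∏ t, u t ^ K t) fun K hK =>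
      (prod_pow_isBigO (Finset.mem_piAntidiag.mp hK).1.ge).const_mul_left _
  refine this.congr_left fun u => ?_
  simp [fiberTerm]

lemma fiberTerm_sub_isBigO (j : Fin n) :
    (fun p : (Fin m → ℂ) × (Fin m → ℂ) =>
      fiberTerm lam P N k j p.1 - fiberTerm lam P N k j p.2) =O[𝓝 (0, 0)]
      fun p => p.1 - p.2 :=
  ((contDiff_fiberTerm j).contDiffAt.hasStrictFDerivAt one_ne_zero).isBigO_sub

/-- The factor of the truncated normal form in the `j`-th component agrees with `1 + f_j` up to
terms of order `k + 1` in the shadow variables. -/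
lemma normalForm_factor_isBigO (hlam : ∀ j, ‖lam j‖ = 1) (hN : IsPoincareDulac lam P N)
    (hk : IsOrderOfNormalForm P N k) {d : ℕ} (hd : k ≤ d) (j : Fin n) :
    (fun u : Fin m → ℂ => (∑ K ∈ boxIndex m d, resCoeff P N K j * ∏ t, u t ^ K t) / lam j -
      (1 + fiberTerm lam P N k j u)) =O[𝓝 0] fun u => ‖u‖ ^ (k + 1) := by
  classical
  have hlam0 : lam j ≠ 0 := fun h0 => by simpa [h0] using hlam j
  have hk1 := hk.one_le
  have h0box : (0 : Fin m → ℕ) ∈ boxIndex m d := by simp [mem_boxIndex]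
  have hkbox : Finset.piAntidiag (Finset.univ : Finset (Fin m)) k =
      (boxIndex m d).filter fun K => ∑ t, K t = k := by
    ext K
    simp only [Finset.mem_piAntidiag, Finset.mem_filter, mem_boxIndex, Finset.mem_univ,
      implies_true, and_true]
    refine ⟨fun h => ⟨fun t => ?_, h⟩, fun h => h.2⟩
    have := Finset.single_le_sum (f := K) (fun _ _ => Nat.zero_le _) (Finset.mem_univ t)
    have h' : ∑ t, K t = k := h
    omega
  have hlow : ∀ u : Fin m → ℂ, 1 + fiberTerm lam P N k j u = ∑ K ∈ boxIndex m d,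
      ((if K = 0 then 1 else 0) +
        if ∑ t, K t = k then resCoeff P N K j / lam j * ∏ t, u t ^ K t else 0) := by
    intro u
    rw [Finset.sum_add_distrib, Finset.sum_ite_eq' _ (0 : Fin m → ℕ), if_pos h0box, fiberTerm,
      hkbox, Finset.sum_filter]
  have hterm : ∀ K ∈ boxIndex m d, (fun u : Fin m → ℂ =>
      resCoeff P N K j / lam j * ∏ t, u t ^ K t - ((if K = 0 then 1 else 0) +
        if ∑ t, K t = k then resCoeff P N K j / lam j * ∏ t, u t ^ K t else 0))
      =O[𝓝 0] fun u => ‖u‖ ^ (k + 1) := by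
    intro K _
    by_cases hK0 : K = 0
    · subst hK0
      have h1 : resCoeff P N 0 j = lam j := by
        rw [resCoeff, comb_zero, add_zero, hN.linear]
      have h2 : ¬ (∑ t : Fin m, (0 : Fin m → ℕ) t = k) := by simp; omega
      simpa [h1, hlam0, if_neg h2, show ¬ (0 = k) by omega] using isBigO_zero _ _
    · by_cases hKk : ∑ t, K t = k
      · simpa [hK0, hKk] using isBigO_zero _ _
      · simp only [hK0, hKk, if_false, add_zero, sub_zero]
        by_cases ha : resCoeff P N K j = 0
        · simpa [ha] using isBigO_zero _ _
        -- Minimality of the weighted order excludes nonzero coefficients with `0 < |K| < k`.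
        · have : k ≤ ∑ t, K t := hk.2 ⟨K, j, hK0, rfl, ha⟩
          exact (prod_pow_isBigO (by omega)).const_mul_left _
  refine (IsBigO.sum hterm).congr_left fun u => ?_
  rw [hlow, Finset.sum_div, ← Finset.sum_sub_distrib, Finset.sum_apply]
  refine Finset.sum_congr rfl fun K _ => ?_
  ring

end FiberTerm

/-! ### Directors and the linearization at `v`. -/

section Directors

variable {n m : ℕ} {k : ℕ} {v : Fin m → ℂ}

/-- The linearization of `-H - (1 / k) id` at `v`. -/
def directorMap (k : ℕ) (H : (Fin m → ℂ) → (Fin m → ℂ)) (v : Fin m → ℂ) :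
    (Fin m → ℂ) →L[ℂ] (Fin m → ℂ) :=
  -(fderiv ℂ H v) - (k : ℂ)⁻¹ • ContinuousLinearMap.id ℂ _

lemma directorMap_apply (H : (Fin m → ℂ) → (Fin m → ℂ)) (w : Fin m → ℂ) :
    directorMap k H v w = -(fderiv ℂ H v w) - (k : ℂ)⁻¹ • w := rfl

/-- Euler's identity in degree `k + 1`. -/
lemma fderiv_self_of_homogeneous {H : (Fin m → ℂ) → (Fin m → ℂ)}
    (hH : DifferentiableAt ℂ H v) (hHh : ∀ (c : ℂ) u, H (c • u) = c ^ (k + 1) • H u) :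
    fderiv ℂ H v v = ((k : ℂ) + 1) • H v := by
  have h1 : HasDerivAt (fun c : ℂ => c • v) v 1 := by
    simpa using (hasDerivAt_id (1 : ℂ)).smul_const v
  have h2 : HasFDerivAt H (fderiv ℂ H v) ((1 : ℂ) • v) := by
    rw [one_smul]
    exact hH.hasFDerivAt
  have h3 := h2.comp_hasDerivAt (1 : ℂ) h1
  have h4 : HasDerivAt (fun c : ℂ => c ^ (k + 1) • H v) (((k : ℂ) + 1) • H v) 1 := by
    have := (hasDerivAt_pow (k + 1) (1 : ℂ)).smul_const (H v)
    simpa using this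
  refine h3.unique ?_
  convert! h4 using 1
  funext c
  exact hHh c v

/-- By Euler's identity `v` is an eigenvector with eigenvalue `1`. The normalization `τ = -1 / k`
gives `(1 / k) (τ⁻¹ dH_v - id) = -dH_v - 1 / k`, so an eigenvector outside `ℂ v` has a director as
eigenvalue. -/
lemma re_pos_of_directorMap_eigenvalue {H : (Fin m → ℂ) → (Fin m → ℂ)} (hk : 1 ≤ k)
    (hH : DifferentiableAt ℂ H v) (hHh : ∀ (c : ℂ) u, H (c • u) = c ^ (k + 1) • H u)
    (hN : IsNormalizedFullyAttractive k H v) (α : ℂ) (w : Fin m → ℂ) (hw : w ≠ 0)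
    (hαw : directorMap k H v w = α • w) : 0 < α.re := by
  have hk0 : (k : ℂ) ≠ 0 := by exact_mod_cast (by omega : k ≠ 0)
  by_cases hwv : w ∈ Submodule.span ℂ {v}
  · obtain ⟨a, rfl⟩ := Submodule.mem_span_singleton.mp hwv
    have h1 : directorMap k H v v = v := by
      rw [directorMap_apply, fderiv_self_of_homogeneous hH hHh, hN.normalized, smul_smul,
        ← neg_smul, ← sub_smul]
      rw [show -(((k : ℂ) + 1) * -(1 / (k : ℂ))) - (k : ℂ)⁻¹ = 1 by field_simp; ring, one_smul]
    rw [map_smul, h1] at hαw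
    have h2 : (1 - α) • (a • v) = 0 := by rw [sub_smul, one_smul, ← hαw, sub_self]
    have h3 := (smul_eq_zero.mp h2).resolve_right hw
    rw [← sub_eq_zero.mp h3]
    norm_num
  · refine hN.directors α ⟨-(1 / (k : ℂ)), by simpa using hk0, hN.normalized, w, hwv, ?_⟩
    have h1 : (1 / (k : ℂ)) • ((-(1 / (k : ℂ)))⁻¹ • fderiv ℂ H v w - w) - α • w = 0 := by
      rw [← hαw, directorMap_apply, smul_sub, smul_smul]
      rw [show 1 / (k : ℂ) * (-(1 / (k : ℂ)))⁻¹ = -1 by field_simp, one_div, neg_one_smul, sub_self]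
    rw [h1]
    exact Submodule.zero_mem _

/-- In a vanishing coordinate of `v`, the shadow decays faster than the parabolic solution. -/
lemma re_factor_lt_of_coord_eq_zero {P : Fin m → (Fin n →₀ ℕ)} {f : Fin n → (Fin m → ℂ) → ℂ}
    (hf : ∀ j, Differentiable ℂ (f j))
    (hpos : ∀ (α : ℂ) (w : Fin m → ℂ), w ≠ 0 →
      directorMap k (shadowField P f) v w = α • w → 0 < α.re) {τ : Fin m} (hv : v τ = 0) :
    (∑ j, (P τ j : ℂ) * f j v).re < -(k : ℝ)⁻¹ := by
  classical
  set h : (Fin m → ℂ) → ℂ := fun u => ∑ j, (P τ j : ℂ) * f j u with hh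
  have hhd : Differentiable ℂ h := by simp only [hh]; fun_prop
  -- The `τ`-component of the field is `u_τ h(u)`, and the derivative of `h` is multiplied by `v τ =
  -- 0`.
  have h1 : ∀ w, fderiv ℂ (shadowField P f) v w τ = h v * w τ := by
    intro w
    have h2 := hasFDerivAt_pi'.mp ((differentiable_shadowField (P := P) hf) v).hasFDerivAt τ
    have h3 : HasFDerivAt (fun u : Fin m → ℂ => u τ)
      (ContinuousLinearMap.proj τ : (Fin m → ℂ) →L[ℂ] ℂ) v :=
      (ContinuousLinearMap.proj τ : (Fin m → ℂ) →L[ℂ] ℂ).hasFDerivAt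
    have h4 := h2.unique (h3.mul (hhd v).hasFDerivAt)
    have h5 := DFunLike.congr_fun h4 w
    simpa [hv] using h5
  set α : ℂ := -h v - (k : ℂ)⁻¹ with hα
  -- The `τ`-component of `directorMap - α` vanishes identically. The map is therefore not
  -- surjective, hence not injective, and `α` is an eigenvalue.
  have h6 : 0 < α.re := by
    by_contra hneg
    have hinj : Function.Injective
        ((directorMap k (shadowField P f) v - α • ContinuousLinearMap.id ℂ _ :
          (Fin m → ℂ) →L[ℂ] (Fin m → ℂ)) : (Fin m → ℂ) →ₗ[ℂ] (Fin m → ℂ)) := by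
      rw [injective_iff_map_eq_zero]
      intro w hw
      by_contra hw0
      exact hneg (hpos α w hw0 (sub_eq_zero.mp hw))
    obtain ⟨w, hw⟩ := LinearMap.injective_iff_surjective.mp hinj (Pi.single τ 1)
    have h7 := congrFun hw τ
    have h8 : directorMap k (shadowField P f) v w τ - α * w τ = (Pi.single τ (1 : ℂ) : Fin m → ℂ) τ :=
      h7
    rw [directorMap_apply, Pi.sub_apply, Pi.neg_apply, h1, Pi.single_eq_same] at h8
    simp only [Pi.smul_apply, smul_eq_mul, hα] at h8
    ring_nf at h8
    exact zero_ne_one h8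
  have h9 : α.re = -(h v).re - (k : ℝ)⁻¹ := by
    rw [hα, Complex.sub_re, Complex.neg_re, ← Complex.ofReal_natCast, ← Complex.ofReal_inv,
      Complex.ofReal_re]
  linarith

end Directors

/-! ### Slices are nonempty for large times. -/

section MonomialMap

variable {n m : ℕ} {P : Fin m → (Fin n →₀ ℕ)}

/-- In logarithmic coordinates this is a linear system with matrix `P`, which has a right inverse
over `ℚ` because its rows are independent. -/
lemma exists_monomMap_eq
    (h : LinearIndependent ℚ (fun t : Fin m => fun j : Fin n => (P t j : ℚ)))
    (b : Fin m → ℂ) (hb : ∀ t, b t ≠ 0) : ∃ c : Fin n → ℂ, monomMap P c = b := by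
  classical
  let M : Matrix (Fin m) (Fin n) ℚ := Matrix.of fun t j => (P t j : ℚ)
  have hrank : M.rank = Fintype.card (Fin m) := LinearIndependent.rank_matrix (M := M) h
  have hsurj : Function.Surjective M.mulVec := by
    have : LinearMap.range M.mulVecLin = ⊤ := by
      refine Submodule.eq_top_of_finrank_eq ?_
      rw [← Matrix.rank, hrank]
      simp
    exact LinearMap.range_eq_top.mp this
  obtain ⟨B, hB⟩ := Matrix.mulVec_surjective_iff_exists_right_inverse.mp hsurj
  let x : Fin n → ℂ := fun j => ∑ s, (B j s : ℂ) * Complex.log (b s)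
  have hx : ∀ t, ∑ j, (P t j : ℂ) * x j = Complex.log (b t) := by
    intro t
    have h1 : ∀ s, ∑ j, (P t j : ℂ) * (B j s : ℂ) = if t = s then 1 else 0 := fun s => by
      have := congrFun (congrFun hB t) s
      rw [Matrix.mul_apply, Matrix.one_apply] at this
      have h2 := congrArg (fun r : ℚ => (r : ℂ)) this
      simp only [M, Matrix.of_apply] at h2
      push_cast at h2
      rw [h2]
      split_ifs <;> simp
    simp only [x, Finset.mul_sum]
    rw [Finset.sum_comm]
    simp only [← mul_assoc, ← Finset.sum_mul, h1]
    simp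
  refine ⟨fun j => Complex.exp (x j), ?_⟩
  funext t
  simp only [monomMap, monom]
  rw [Finset.prod_congr rfl fun j _ => (Complex.exp_nat_mul (x j) (P t j)).symm,
    ← Complex.exp_sum, hx, Complex.exp_log (hb t)]

variable {f : Fin n → (Fin m → ℂ) → ℂ} {k : ℕ} {v : Fin m → ℂ}

/-- The witness `w_j = c_j t ^ (Re f_j(v))` imitates the expected decay. Where `v τ ≠ 0`, the
equation `H(v) = -v / k` makes `u_τ` decay exactly like `t ^ (-1 / k)`, and `c` supplies the
constant `σ v_τ`. Where `v τ = 0`, the monomial map is only known to reach nonzero values, so `c`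
gives the constant `1`, and the strict inequality `hv0` sends the rescaled coordinate to `0`. -/
lemma eventually_exists_mem_timeSlice
    (h : LinearIndependent ℚ (fun t : Fin m => fun j : Fin n => (P t j : ℚ)))
    {p : Seminorm ℂ (Fin m → ℂ)} {C : ℝ} (hC : ∀ y, p y ≤ C * ‖y‖) {σ : ℂ} (hσ : σ ≠ 0)
    {η β : ℝ} (hη : 0 < η) (hβ : ∀ j, (f j v).re < -β)
    (hv : shadowField P f v = (-(1 / (k : ℂ))) • v)
    (hv0 : ∀ τ, v τ = 0 → (∑ j, (P τ j : ℂ) * f j v).re < -(k : ℝ)⁻¹) :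
    ∀ᶠ t : ℝ in atTop, (timeSlice P p v k σ η β t).Nonempty := by
  classical
  obtain ⟨c, hc⟩ := exists_monomMap_eq h (fun τ => if v τ = 0 then 1 else σ * v τ) fun τ => by
    split_ifs with h0
    · exact one_ne_zero
    · exact mul_ne_zero hσ h0
  let w : ℝ → Fin n → ℂ := fun t j => c j * ((t ^ (f j v).re : ℝ) : ℂ)
  set e : Fin m → ℝ := fun τ => (∑ j, (P τ j : ℂ) * f j v).re with he
  have he' : ∀ τ, e τ = ∑ j, (P τ j : ℝ) * (f j v).re := fun τ => by
    simp only [he, Complex.re_sum]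
    refine Finset.sum_congr rfl fun j _ => ?_
    rw [← Complex.ofReal_natCast, Complex.re_ofReal_mul]
  have hu : ∀ t : ℝ, 0 < t → ∀ τ, monomMap P (w t) τ =
      (if v τ = 0 then 1 else σ * v τ) * ((t ^ e τ : ℝ) : ℂ) := by
    intro t ht τ
    have h1 := monom_mul c (fun j => ((t ^ (f j v).re : ℝ) : ℂ)) (P τ)
    have h2 : monom c (P τ) = if v τ = 0 then 1 else σ * v τ := congrFun hc τ
    have h3 : monom (fun j => ((t ^ (f j v).re : ℝ) : ℂ)) (P τ) = ((t ^ e τ : ℝ) : ℂ) := by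
      rw [monom, he', Real.rpow_sum_of_pos ht, Complex.ofReal_prod]
      refine Finset.prod_congr rfl fun j _ => ?_
      rw [mul_comm, Real.rpow_mul_natCast ht.le, Complex.ofReal_pow]
    rw [h2, h3] at h1
    exact h1
  have htend : Tendsto (fun t => rescaled k σ t (monomMap P (w t))) atTop (𝓝 v) := by
    rw [tendsto_pi_nhds]
    intro τ
    by_cases hvτ : v τ = 0
    · rw [hvτ]
      have h1 : Tendsto (fun t : ℝ => t ^ ((k : ℝ)⁻¹ + e τ)) atTop (𝓝 0) := by
        have h2 : 0 < -((k : ℝ)⁻¹ + e τ) := by have := hv0 τ hvτ; simp only [he]; linarith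
        simpa using tendsto_rpow_neg_atTop h2
      have h3 : Tendsto (fun t : ℝ => σ⁻¹ * ((t ^ ((k : ℝ)⁻¹ + e τ) : ℝ) : ℂ)) atTop (𝓝 0) := by
        simpa using (Complex.continuous_ofReal.tendsto' 0 0 rfl |>.comp h1).const_mul σ⁻¹
      refine h3.congr' ?_
      filter_upwards [eventually_gt_atTop 0] with t ht
      rw [rescaled, Pi.smul_apply, hu t ht, if_pos hvτ, smul_eq_mul, Real.rpow_add ht]
      push_cast
      ring
    · have h1 : e τ = -(k : ℝ)⁻¹ := by
        have h2 := congrFun hv τ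
        simp only [shadowField, Pi.smul_apply, smul_eq_mul] at h2
        rw [mul_comm] at h2
        have h3 := mul_right_cancel₀ hvτ h2
        simp only [he]
        rw [h3, one_div, Complex.neg_re, ← Complex.ofReal_natCast, ← Complex.ofReal_inv,
          Complex.ofReal_re]
      refine tendsto_const_nhds.congr' ?_
      filter_upwards [eventually_gt_atTop 0] with t ht
      rw [rescaled, Pi.smul_apply, hu t ht, if_neg hvτ, smul_eq_mul, h1]
      have h4 : ((t ^ (k : ℝ)⁻¹ : ℝ) : ℂ) * ((t ^ (-(k : ℝ)⁻¹) : ℝ) : ℂ) = 1 := by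
        rw [← Complex.ofReal_mul, ← Real.rpow_add ht, add_neg_cancel, Real.rpow_zero,
          Complex.ofReal_one]
      linear_combination (-(σ⁻¹ * σ * v τ)) * h4 - v τ * inv_mul_cancel₀ hσ
  have h1 : ∀ᶠ t in atTop, p (rescaled k σ t (monomMap P (w t)) - v) < η := by
    have h2 : Tendsto (fun t => C * ‖rescaled k σ t (monomMap P (w t)) - v‖) atTop (𝓝 0) := by
      simpa using ((htend.sub_const v).norm).const_mul C
    filter_upwards [h2.eventually_lt_const hη] with t ht
    exact (hC _).trans_lt ht
  have h2 : ∀ᶠ t in atTop, ∀ j, ‖w t j‖ < t ^ (-β) := by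
    rw [eventually_all]
    intro j
    have h3 : 0 < -((f j v).re + β) := by have := hβ j; linarith
    have h4 : Tendsto (fun t : ℝ => ‖c j‖ * t ^ ((f j v).re + β)) atTop (𝓝 0) := by
      have := (tendsto_rpow_neg_atTop h3).const_mul ‖c j‖
      simpa using this
    filter_upwards [h4.eventually_lt_const one_pos, eventually_gt_atTop 0] with t ht ht0
    have h5 : 0 < t ^ (-β) := Real.rpow_pos_of_pos ht0 _
    have h6 : t ^ (f j v).re = t ^ ((f j v).re + β) * t ^ (-β) := by
      rw [← Real.rpow_add ht0, add_neg_cancel_right]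
    simp only [w]
    rw [norm_mul, Complex.norm_real, Real.norm_of_nonneg (by positivity), h6, ← mul_assoc]
    exact mul_lt_of_lt_one_left h5 ht
  filter_upwards [h1, h2] with t h1 h2
  exact ⟨w t, h1, h2⟩

end MonomialMap

/-! ### From slices to pairwise disjoint basins. -/

/-- An open forward invariant set with `0` in its closure is an attracting basin if orbits in it
converge to `0` and `0` is Lyapunov stable within it. -/
lemma isAttractingBasin_of_stable {n : ℕ} {G : (Fin n → ℂ) → (Fin n → ℂ)} {U : Set (Fin n → ℂ)}
    (hU : IsOpen U) (hcl : (0 : Fin n → ℂ) ∈ closure U) (hmaps : Set.MapsTo G U U)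
    (hconv : ∀ z ∈ U, Tendsto (fun l : ℕ => G^[l] z) atTop (𝓝 0))
    (hstab : ∀ ε > 0, ∃ δ > 0, ∀ z ∈ U, ‖z‖ < δ → ∀ l : ℕ, ‖G^[l] z‖ < ε) :
    IsAttractingBasin G U := by
  -- Each `Ω j` controls the whole orbit of its points lying in `U`, which makes `U ∩ Ω j`
  -- invariant. Stability is what makes `Ω j` a neighbourhood of `0`.
  refine ⟨closure_nonempty_iff.mp ⟨0, hcl⟩, hU, hcl,
    fun j => {z | ‖z‖ < 1 / ((j : ℝ) + 1) ∧ (z ∈ U → ∀ l : ℕ, ‖G^[l] z‖ < 1 / ((j : ℝ) + 1))},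
    ⟨fun s => ⟨fun hs => ?_, ?_⟩⟩, ?_, ?_⟩
  · obtain ⟨ε, hε, hball⟩ := Metric.mem_nhds_iff.mp hs
    obtain ⟨j, hj⟩ := exists_nat_one_div_lt hε
    exact ⟨j, trivial, fun z hz => hball (by simpa using hz.1.trans hj)⟩
  · rintro ⟨j, -, hj⟩
    refine mem_of_superset ?_ hj
    have hj0 : 0 < 1 / ((j : ℝ) + 1) := by positivity
    obtain ⟨δ, hδ, hst⟩ := hstab _ hj0
    filter_upwards [Metric.ball_mem_nhds (0 : Fin n → ℂ) (lt_min hδ hj0)] with z hz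
    rw [Metric.mem_ball, dist_zero_right, lt_min_iff] at hz
    exact ⟨hz.2, fun hzU => hst z hzU hz.1⟩
  · rintro j z ⟨hzU, hz⟩
    have h1 := hz.2 hzU
    exact ⟨hmaps hzU, h1 1, fun _ l => by simpa using h1 (l + 1)⟩
  · exact fun j z hz => hconv z hz.1

lemma continuous_rescaled {m : ℕ} (k : ℕ) (σ : ℂ) (t : ℝ) :
    Continuous (rescaled k σ t : (Fin m → ℂ) → Fin m → ℂ) :=
  continuous_const_smul _

lemma isOpen_timeSlice {n m : ℕ} (P : Fin m → (Fin n →₀ ℕ)) {p : Seminorm ℂ (Fin m → ℂ)}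
    {C : ℝ} (hC : ∀ y, p y ≤ C * ‖y‖) (v : Fin m → ℂ) (k : ℕ) (σ : ℂ) (η β t : ℝ) :
    IsOpen (timeSlice P p v k σ η β t) := by
  have hp : Continuous p := by
    refine Seminorm.continuous_of_continuousAt_zero ?_
    have h1 : Tendsto (fun y : Fin m → ℂ => C * ‖y‖) (𝓝 0) (𝓝 0) := by
      have : Continuous fun y : Fin m → ℂ => C * ‖y‖ := by fun_prop
      simpa using this.tendsto 0
    rw [ContinuousAt, map_zero]
    exact squeeze_zero (fun y => apply_nonneg p y) hC h1
  have h2 : timeSlice P p v k σ η β t = {w | p (rescaled k σ t (monomMap P w) - v) < η} ∩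
      ⋂ j, {w : Fin n → ℂ | ‖w j‖ < t ^ (-β)} := by
    ext w
    simp [timeSlice]
  rw [h2]
  refine IsOpen.inter (isOpen_lt (hp.comp (((continuous_rescaled k σ t).comp
    (continuous_monomMap P)).sub continuous_const)) continuous_const) ?_
  exact isOpen_iInter_of_finite fun j => isOpen_lt (continuous_apply j).norm continuous_const

/-- Two solutions `σ t ^ (-1 / k) v` with different phases `σ` stay apart. -/
lemma disjoint_rescaled {m : ℕ} {k : ℕ} {v : Fin m → ℂ} {σ₁ σ₂ : ℂ} (h₁ : ‖σ₁‖ = 1)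
    (h₂ : ‖σ₂‖ = 1) {η : ℝ} (hη : 2 * η < ‖σ₁ - σ₂‖ * ‖v‖) {t₁ t₂ : ℝ} (ht₁ : 0 < t₁)
    (ht₂ : 0 < t₂) {u : Fin m → ℂ} (hu₁ : ‖rescaled k σ₁ t₁ u - v‖ < η)
    (hu₂ : ‖rescaled k σ₂ t₂ u - v‖ < η) : False := by
  have hσ₁ : σ₁ ≠ 0 := fun h => by simp [h] at h₁
  have hσ₂ : σ₂ ≠ 0 := fun h => by simp [h] at h₂
  set a : ℝ := t₁ ^ (-(k : ℝ)⁻¹) with ha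
  set b : ℝ := t₂ ^ (-(k : ℝ)⁻¹) with hb
  have ha0 : 0 < a := Real.rpow_pos_of_pos ht₁ _
  have hb0 : 0 < b := Real.rpow_pos_of_pos ht₂ _
  set y₁ := rescaled k σ₁ t₁ u - v with hy₁
  set y₂ := rescaled k σ₂ t₂ u - v with hy₂
  have e₁ : u = (σ₁ * (a : ℂ)) • (v + y₁) := by
    rw [hy₁, add_sub_cancel]
    exact eq_smul_rescaled hσ₁ ht₁ u
  have e₂ : u = (σ₂ * (b : ℂ)) • (v + y₂) := by
    rw [hy₂, add_sub_cancel]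
    exact eq_smul_rescaled hσ₂ ht₂ u
  have e₃ : (σ₁ * (a : ℂ) - σ₂ * b) • v = (σ₂ * (b : ℂ)) • y₂ - (σ₁ * (a : ℂ)) • y₁ := by
    have := e₁.symm.trans e₂
    rw [smul_add, smul_add] at this
    rw [sub_smul, sub_eq_sub_iff_add_eq_add, this, add_comm]
  have e₄ : ‖σ₁ * (a : ℂ) - σ₂ * b‖ * ‖v‖ ≤ b * ‖y₂‖ + a * ‖y₁‖ := by
    rw [← norm_smul, e₃]
    refine (norm_sub_le _ _).trans_eq ?_
    rw [norm_smul, norm_smul, norm_mul, norm_mul, h₁, h₂, Complex.norm_real, Complex.norm_real,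
      Real.norm_of_nonneg ha0.le, Real.norm_of_nonneg hb0.le, one_mul, one_mul]
  -- With `c = Re (σ₁ conj σ₂)`, the difference of the squares of the two sides is `2 (1 + c) (a -
  -- b)² ≥ 0`. The separation is thus uniform in the two times.
  have e₅ : ‖σ₁ - σ₂‖ * (a + b) ≤ 2 * ‖σ₁ * (a : ℂ) - σ₂ * b‖ := by
    have hs : ∀ x y : ℂ, ‖x‖ = 1 → ‖y‖ = 1 → ∀ r s : ℝ, ‖x * (r : ℂ) - y * s‖ ^ 2 =
        r ^ 2 + s ^ 2 - 2 * r * s * (x.re * y.re + x.im * y.im) := by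
      intro x y hx hy r s
      have hx2 : x.re * x.re + x.im * x.im = 1 := by
        rw [← Complex.normSq_apply, Complex.normSq_eq_norm_sq, hx, one_pow]
      have hy2 : y.re * y.re + y.im * y.im = 1 := by
        rw [← Complex.normSq_apply, Complex.normSq_eq_norm_sq, hy, one_pow]
      rw [← Complex.normSq_eq_norm_sq, Complex.normSq_apply]
      simp only [Complex.sub_re, Complex.sub_im, Complex.mul_re, Complex.mul_im,
        Complex.ofReal_re, Complex.ofReal_im, mul_zero, sub_zero, zero_add]
      linear_combination r ^ 2 * hx2 + s ^ 2 * hy2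
    have h3 := hs σ₁ σ₂ h₁ h₂ 1 1
    have h4 := hs σ₁ σ₂ h₁ h₂ a b
    simp only [Complex.ofReal_one, mul_one, one_pow] at h3
    set c := σ₁.re * σ₂.re + σ₁.im * σ₂.im
    have hc : -1 ≤ c := by
      have h5 := hs σ₁ σ₂ h₁ h₂ 1 (-1)
      nlinarith [sq_nonneg ‖σ₁ * ((1 : ℝ) : ℂ) - σ₂ * ((-1 : ℝ) : ℂ)‖]
    refine abs_le_of_sq_le_sq' ?_ (by positivity) |>.2
    rw [mul_pow, mul_pow, h3, h4]
    nlinarith [mul_nonneg (sq_nonneg (a - b)) (by linarith : 0 ≤ 1 + c)]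
  nlinarith [norm_nonneg v, mul_lt_mul_of_pos_left hu₁ ha0, mul_lt_mul_of_pos_left hu₂ hb0,
    mul_le_mul_of_nonneg_right e₅ (norm_nonneg v),
    mul_lt_mul_of_pos_right hη (add_pos ha0 hb0)]

section Basin

variable {n m : ℕ} {P : Fin m → (Fin n →₀ ℕ)} {p : Seminorm ℂ (Fin m → ℂ)} {v : Fin m → ℂ}
  {k : ℕ} {σ : ℂ} {η β : ℝ} {χ G : (Fin n → ℂ) → (Fin n → ℂ)} {C : ℝ} {r : ℝ}

lemma norm_lt_of_mem_timeSlice {t : ℝ} (ht : 0 < t) {w : Fin n → ℂ}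
    (hw : w ∈ timeSlice P p v k σ η β t) : ‖w‖ ≤ t ^ (-β) :=
  (pi_norm_le_iff_of_nonneg (Real.rpow_pos_of_pos ht _).le).mpr fun j => (hw.2 j).le

/-- If `G` maps time-`t` slices into time-`(t + 1)` slices, then the union of the slices for large
times is an attracting basin. -/
lemma exists_basin_of_slices (hP0 : monomMap P (0 : Fin n → ℂ) = 0)
    (hp : ∀ y, ‖y‖ ≤ p y) {C' : ℝ} (hC' : ∀ y, p y ≤ C' * ‖y‖) (hηv : η < ‖v‖) (hβ : 0 < β)
    (hσ : σ ≠ 0) (hχ : Continuous χ) (hχ0 : χ 0 = 0) (hχm : map χ (𝓝 0) = 𝓝 0) (hr : 0 < r)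
    (hC : 0 < C) (hrC : ∀ z, ‖z‖ < r → ‖z‖ ≤ C * ‖χ z‖)
    (hne : ∀ᶠ t : ℝ in atTop, (timeSlice P p v k σ η β t).Nonempty)
    (hstep : ∃ R : ℝ, ∀ t > R, ∀ z, ‖z‖ < r → χ z ∈ timeSlice P p v k σ η β t →
      ‖G z‖ < r ∧ χ (G z) ∈ timeSlice P p v k σ η β (t + 1)) :
    ∃ U : Set (Fin n → ℂ), IsAttractingBasin G U ∧ (0 : Fin n → ℂ) ∈ frontier U ∧
      ∀ z ∈ U, ∃ t > 0, p (rescaled k σ t (monomMap P (χ z)) - v) < η := by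
  obtain ⟨R₀, hstep⟩ := hstep
  set R : ℝ := max R₀ 0 with hR
  have hR0 : 0 ≤ R := le_max_right _ _
  have hstep : ∀ t > R, ∀ z, ‖z‖ < r → χ z ∈ timeSlice P p v k σ η β t →
      ‖G z‖ < r ∧ χ (G z) ∈ timeSlice P p v k σ η β (t + 1) := fun t ht =>
    hstep t ((le_max_left _ _).trans_lt ht)
  set U : Set (Fin n → ℂ) := {z | ∃ t > R, ‖z‖ < r ∧ χ z ∈ timeSlice P p v k σ η β t} with hU
  have hiter : ∀ t > R, ∀ z, ‖z‖ < r → χ z ∈ timeSlice P p v k σ η β t → ∀ l : ℕ,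
      ‖G^[l] z‖ < r ∧ χ (G^[l] z) ∈ timeSlice P p v k σ η β (t + l) := by
    intro t ht z hz hzt l
    induction l with
    | zero => simpa using ⟨hz, hzt⟩
    | succ l ih =>
      have := hstep (t + l) (by have : (0 : ℝ) ≤ l := Nat.cast_nonneg l
                                linarith) _ ih.1 ih.2
      rw [Function.iterate_succ_apply', Nat.cast_succ, ← add_assoc]
      exact this
  have hbound : ∀ t > R, ∀ z, ‖z‖ < r → χ z ∈ timeSlice P p v k σ η β t → ∀ l : ℕ,
      ‖G^[l] z‖ ≤ C * (t + l) ^ (-β) := by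
    intro t ht z hz hzt l
    obtain ⟨h1, h2⟩ := hiter t ht z hz hzt l
    have h3 : (0 : ℝ) < t + l := by
      have : (0 : ℝ) ≤ l := Nat.cast_nonneg l
      linarith
    exact (hrC _ h1).trans (mul_le_mul_of_nonneg_left (norm_lt_of_mem_timeSlice h3 h2) hC.le)
  have hopen : IsOpen U := by
    have : U = ⋃ t ∈ Set.Ioi R, (Metric.ball 0 r ∩ χ ⁻¹' timeSlice P p v k σ η β t) := by
      ext z
      simp only [hU, Set.mem_ofPred_eq, Set.mem_iUnion, Set.mem_inter_iff, Set.mem_preimage,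
        Metric.mem_ball, dist_zero_right, Set.mem_Ioi, exists_prop, gt_iff_lt]
    rw [this]
    exact isOpen_biUnion fun t _ => Metric.isOpen_ball.inter
      ((isOpen_timeSlice P hC' v k σ η β t).preimage hχ)
  -- At `z = 0` the rescaled variable is `0`, whose distance `p v ≥ ‖v‖` from `v` exceeds `η`.
  have h0 : (0 : Fin n → ℂ) ∉ U := by
    rintro ⟨t, -, -, h1, -⟩
    rw [hχ0, hP0, rescaled, smul_zero, zero_sub, map_neg_eq_map] at h1
    exact absurd (hp v) (by linarith)
  have hrpow : ∀ ε > 0, ∃ T > 0, ∀ t ≥ T, C * t ^ (-β) < ε := by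
    intro ε hε
    have h1 : Tendsto (fun t : ℝ => C * t ^ (-β)) atTop (𝓝 0) := by
      simpa using (tendsto_rpow_neg_atTop hβ).const_mul C
    obtain ⟨T, hT⟩ := eventually_atTop.mp (h1.eventually_lt_const hε)
    exact ⟨max T 1, by positivity, fun t ht => hT t ((le_max_left _ _).trans ht)⟩
  have hcl : (0 : Fin n → ℂ) ∈ closure U := by
    rw [mem_closure_iff_frequently]
    -- Points of late slices accumulate at `0`. The identity `map χ (𝓝 0) = 𝓝 0` carries this back
    -- to the original coordinates.
    have hw : ∃ᶠ w in 𝓝 (0 : Fin n → ℂ), ∃ t > R, w ∈ timeSlice P p v k σ η β t := by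
      rw [frequently_iff]
      intro s hs
      obtain ⟨ε, hε, hball⟩ := Metric.mem_nhds_iff.mp hs
      have h1 : Tendsto (fun t : ℝ => t ^ (-β)) atTop (𝓝 0) := tendsto_rpow_neg_atTop hβ
      obtain ⟨t, ⟨⟨w, hw⟩, ht⟩, htR⟩ := ((hne.and (h1.eventually_lt_const hε)).and
        (eventually_gt_atTop R)).exists
      refine ⟨w, hball ?_, t, htR, hw⟩
      rw [Metric.mem_ball, dist_zero_right]
      exact (norm_lt_of_mem_timeSlice (hR0.trans_lt htR) hw).trans_lt ht
    rw [← hχm, frequently_map] at hw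
    refine (hw.and_eventually (Metric.ball_mem_nhds (0 : Fin n → ℂ) hr)).mono ?_
    rintro z ⟨⟨t, ht, hzt⟩, hz⟩
    exact ⟨t, ht, by simpa using hz, hzt⟩
  refine ⟨U, isAttractingBasin_of_stable hopen hcl ?_ ?_ ?_, ?_, ?_⟩
  · rintro z ⟨t, ht, hz, hzt⟩
    exact ⟨t + 1, by linarith, hstep t ht z hz hzt⟩
  · rintro z ⟨t, ht, hz, hzt⟩
    refine squeeze_zero_norm (hbound t ht z hz hzt) ?_
    have h1 : Tendsto (fun l : ℕ => t + (l : ℝ)) atTop atTop :=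
      tendsto_atTop_add_const_left _ _ tendsto_natCast_atTop_atTop
    simpa using ((tendsto_rpow_neg_atTop hβ).comp h1).const_mul C
  -- Stability: on a slice the rescaled `u` has norm at least `‖v‖ - η`. A small `z`, hence a small
  -- `u`, therefore forces `t ≥ T`, and the whole later orbit is below `ε`.
  · intro ε hε
    obtain ⟨T, hT0, hT⟩ := hrpow ε hε
    have hb : 0 < (‖v‖ - η) / ‖σ⁻¹‖ * T ^ (-(k : ℝ)⁻¹) := by
      have h1 : 0 < ‖v‖ - η := by linarith
      have h2 : 0 < ‖σ⁻¹‖ := norm_pos_iff.mpr (inv_ne_zero hσ)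
      positivity
    have hcont : Tendsto (fun z => ‖monomMap P (χ z)‖) (𝓝 0) (𝓝 0) := by
      have : Continuous fun z => ‖monomMap P (χ z)‖ := ((continuous_monomMap P).comp hχ).norm
      simpa [hχ0, hP0] using this.tendsto 0
    obtain ⟨δ, hδ, hball⟩ := Metric.eventually_nhds_iff_ball.mp (hcont.eventually_lt_const hb)
    refine ⟨δ, hδ, ?_⟩
    rintro z ⟨t, ht, hz, hzt⟩ hzδ l
    refine (hbound t ht z hz hzt l).trans_lt (hT _ ?_)
    have ht0 : 0 < t := by linarith
    suffices T ≤ t by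
      have : (0 : ℝ) ≤ l := Nat.cast_nonneg l
      linarith
    by_contra hlt
    have h1 := hball z (by simpa using hzδ)
    have h2 : ‖v‖ - η ≤ ‖rescaled k σ t (monomMap P (χ z))‖ := by
      have h3 := (hp _).trans_lt hzt.1
      have h4 := norm_sub_norm_le v (v - rescaled k σ t (monomMap P (χ z)))
      rw [sub_sub_cancel, norm_sub_rev] at h4
      linarith
    have hσp : 0 < ‖σ⁻¹‖ := norm_pos_iff.mpr (inv_ne_zero hσ)
    rw [rescaled, norm_smul, norm_mul, Complex.norm_real,
      Real.norm_of_nonneg (by positivity)] at h2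
    have h5 : t ^ (k : ℝ)⁻¹ ≤ T ^ (k : ℝ)⁻¹ :=
      Real.rpow_le_rpow ht0.le (le_of_not_ge hlt) (by positivity)
    have h6 : 0 < T ^ (k : ℝ)⁻¹ := Real.rpow_pos_of_pos hT0 _
    rw [Real.rpow_neg hT0.le, ← div_eq_mul_inv, lt_div_iff₀ h6, lt_div_iff₀ hσp] at h1
    have h7 : t ^ (k : ℝ)⁻¹ * ‖σ⁻¹‖ * ‖monomMap P (χ z)‖ ≤
        T ^ (k : ℝ)⁻¹ * ‖σ⁻¹‖ * ‖monomMap P (χ z)‖ := by gcongr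
    linarith
  · rw [hopen.frontier_eq]
    exact ⟨hcl, h0⟩
  · rintro z ⟨t, ht, -, hzt⟩
    exact ⟨t, hR0.trans_lt ht, hzt.1⟩

end Basin

/-! ### Constants, and the step for the inverse germ. -/

lemma exists_forall_re_lt_neg {n : ℕ} {a : Fin n → ℂ} (ha : ∀ j, (a j).re < 0) :
    ∃ β > 0, ∀ j, (a j).re < -(2 * β) := by
  have h1 : ∀ᶠ β : ℝ in 𝓝[>] 0, ∀ j, (a j).re < -(2 * β) := by
    rw [eventually_all]
    intro j
    have h2 : Tendsto (fun β : ℝ => -(2 * β)) (𝓝[>] 0) (𝓝 0) := by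
      have : Continuous fun β : ℝ => -(2 * β) := by fun_prop
      simpa using (this.tendsto 0).mono_left nhdsWithin_le_nhds
    exact h2.eventually_const_lt (ha j)
  obtain ⟨β, hβ, hβ0⟩ := (h1.and self_mem_nhdsWithin).exists
  exact ⟨β, hβ0, hβ⟩

/-- Near a point `v` with `H(v) = -v / k`, the shadow field is controlled by the director map. -/
lemma exists_slice_width {n m : ℕ} {P : Fin m → (Fin n →₀ ℕ)} {f : Fin n → (Fin m → ℂ) → ℂ}
    {k : ℕ} {v : Fin m → ℂ} (hf : ∀ j, Differentiable ℂ (f j))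
    (hv : shadowField P f v = (-(1 / (k : ℂ))) • v) {β : ℝ}
    (hβ : ∀ j, (f j v).re < -(2 * β)) {p : Seminorm ℂ (Fin m → ℂ)} (hp : ∀ y, ‖y‖ ≤ p y)
    {C : ℝ} (hC0 : 0 < C) (hC : ∀ y, p y ≤ C * ‖y‖) {c : ℝ} (hc : 0 < c) :
    ∃ η₀ > 0, ∀ y, p y < η₀ → (∀ j, (f j (v + y)).re ≤ -(2 * β)) ∧
      p ((k : ℂ)⁻¹ • (v + y) + shadowField P f (v + y) +
        directorMap k (shadowField P f) v y) ≤ c / 2 * p y := by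
  have h1 : ∀ᶠ y in 𝓝 (0 : Fin m → ℂ), ∀ j, (f j (v + y)).re < -(2 * β) := by
    rw [eventually_all]
    intro j
    have h2 : Continuous fun y => (f j (v + y)).re :=
      Complex.continuous_re.comp ((hf j).continuous.comp (continuous_const.add continuous_id))
    have h3 := h2.tendsto 0
    rw [add_zero] at h3
    exact h3.eventually_lt_const (hβ j)
  have h4 := hasFDerivAt_iff_isLittleO_nhds_zero.mp
    (differentiable_shadowField (P := P) hf v).hasFDerivAt
  have h5 := h4.bound (show 0 < c / (2 * C) by positivity)
  obtain ⟨η₀, hη₀, hball⟩ := Metric.eventually_nhds_iff_ball.mp (h1.and h5)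
  refine ⟨η₀, hη₀, fun y hy => ?_⟩
  obtain ⟨h6, h7⟩ := hball y (by simpa using (hp y).trans_lt hy)
  refine ⟨fun j => (h6 j).le, ?_⟩
  have h8 : (k : ℂ)⁻¹ • (v + y) + shadowField P f (v + y) +
      directorMap k (shadowField P f) v y =
      shadowField P f (v + y) - shadowField P f v - fderiv ℂ (shadowField P f) v y := by
    rw [directorMap_apply, hv, neg_smul, one_div, smul_add]
    abel
  rw [h8]
  calc _ ≤ C * (c / (2 * C) * ‖y‖) := (hC _).trans (mul_le_mul_of_nonneg_left h7 hC0.le)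
    _ = c / 2 * ‖y‖ := by field_simp
    _ ≤ c / 2 * p y := mul_le_mul_of_nonneg_left (hp y) (by positivity)

section InverseBasin

variable {n m : ℕ} {F G : (Fin n → ℂ) → (Fin n → ℂ)} {lam : Fin n → ℂ}
  {P : Fin m → (Fin n →₀ ℕ)} {N : Fin n → MvPowerSeries (Fin n) ℂ} {k : ℕ}

lemma IsInverseGerm.isBigO_id (hG : IsInverseGerm F G) : G =O[𝓝 0] fun z => z := by
  have h1 := hG.analyticAt.differentiableAt.isBigO_sub
  simpa [hG.map_zero] using h1

lemma IsInverseGerm.tendsto (hG : IsInverseGerm F G) : Tendsto G (𝓝 0) (𝓝 0) := by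
  have := hG.analyticAt.continuousAt.tendsto
  rwa [hG.map_zero] at this

/-- In suitable polynomial coordinates, the inverse germ is a product map with factors
`lam_j⁻¹ (1 - f_j(u) + ⋯)` up to terms of order `d + 1`. -/
lemma IsInverseGerm.exists_factor (hG : IsInverseGerm F G)
    (hres : IsResonantWithGenerators lam P) (hlam : ∀ j, ‖lam j‖ = 1)
    (hN : IsPoincareDulac lam P N) (hk : IsOrderOfNormalForm P N k) {d : ℕ} (hd : k ≤ d)
    {χ : (Fin n → ℂ) → (Fin n → ℂ)} (hχ : Continuous χ) (hχ0 : χ 0 = 0)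
    (hχF : ∀ j, (fun z => χ (F z) j - χ z j * ∑ K ∈ boxIndex m d,
      resCoeff P N K j * ∏ t, monomMap P (χ z) t ^ K t) =O[𝓝 0] fun z => ‖z‖ ^ (d + 1)) :
    ∃ q : (Fin n → ℂ) → Fin n → ℂ,
      (∀ j, (fun z => χ (G z) j - (lam j)⁻¹ * χ z j * q z j) =O[𝓝 0] fun z => ‖z‖ ^ (d + 1)) ∧
      ∀ j, (fun z => q z j - (1 - fiberTerm lam P N k j (monomMap P (χ z)))) =O[𝓝 0]
        fun z => ‖monomMap P (χ z)‖ ^ (k + 1) + ‖z‖ ^ (d + 1) := by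
  have hχt : Tendsto χ (𝓝 0) (𝓝 0) := hχ.tendsto' 0 0 hχ0
  refine exists_inverse_factor (w := χ) (w' := fun z => χ (G z)) hχt (hχt.comp hG.tendsto)
    (norm_pow_isBigO_one _) (fun z => by positivity) hk.one_le hlam
    (hres.monomMap_eq_one hlam) (monomMap_zero hres.linearIndependent)
    (normalForm_factor_isBigO hlam hN hk hd) fiberTerm_isBigO fiberTerm_sub_isBigO fun j => ?_
  have h1 := ((hχF j).comp_tendsto hG.tendsto).trans (hG.isBigO_id.norm_norm.pow (d + 1))
  refine h1.congr' ?_ EventuallyEq.rfl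
  have hlam0 : lam j ≠ 0 := fun h0 => by simpa [h0] using hlam j
  filter_upwards [hG.right_inv] with z hz
  simp only [Function.comp_apply]
  rw [hz]
  field_simp

/-- The filter `L` on pairs `(t, z)`, with `t → ∞` and `χ z` in the slice at time `t`, makes the
asymptotic estimates uniform over each slice. Along it `z = O(t ^ (-β))` and `u = O(t ^ (-1 / k))`.
-/
lemma IsInverseGerm.eventually_step (hG : IsInverseGerm F G)
    (hres : IsResonantWithGenerators lam P) (hlam : ∀ j, ‖lam j‖ = 1)
    (hN : IsPoincareDulac lam P N) (hk : IsOrderOfNormalForm P N k) {d : ℕ} (hd : k ≤ d)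
    {χ : (Fin n → ℂ) → (Fin n → ℂ)} (hχ : Continuous χ) (hχ0 : χ 0 = 0)
    (hχF : ∀ j, (fun z => χ (F z) j - χ z j * ∑ K ∈ boxIndex m d,
      resCoeff P N K j * ∏ t, monomMap P (χ z) t ^ K t) =O[𝓝 0] fun z => ‖z‖ ^ (d + 1))
    {v : Fin m → ℂ} {σ : ℂ} (hσ : σ ^ k = -1)
    {p : Seminorm ℂ (Fin m → ℂ)} (hp : ∀ y, ‖y‖ ≤ p y) {C : ℝ} (hC : ∀ y, p y ≤ C * ‖y‖)
    {A : (Fin m → ℂ) →L[ℂ] (Fin m → ℂ)} {c s₀ : ℝ} (hc : 0 < c) (hs₀ : 0 < s₀)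
    (hA : ∀ s : ℝ, 0 ≤ s → s ≤ s₀ → ∀ y, p (y - (s : ℂ) • A y) ≤ (1 - c * s) * p y)
    {η β : ℝ} (hη : 0 < η) (hβ : 0 < β) (hdβ : 1 + β + (k : ℝ)⁻¹ < β * (d + 1))
    (hre : ∀ y, p y < η → (∀ j, (fiberTerm lam P N k j (v + y)).re ≤ -(2 * β)) ∧
      p ((k : ℂ)⁻¹ • (v + y) + shadowField P (fiberTerm lam P N k) (v + y) + A y) ≤ c / 2 * p y)
    {B r : ℝ} (hB : 0 < B) (hr : 0 < r) (hBr : ∀ z, ‖z‖ < r → ‖z‖ ≤ B * ‖χ z‖) :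
    ∃ R : ℝ, ∀ t > R, ∀ z, ‖z‖ < r → χ z ∈ timeSlice P p v k σ η β t →
      ‖G z‖ < r ∧ χ (G z) ∈ timeSlice P p v k σ η β (t + 1) := by
  obtain ⟨q, hq1, hq2⟩ := hG.exists_factor hres hlam hN hk hd hχ hχ0 hχF
  have hk1 := hk.one_le
  have hσ0 : σ ≠ 0 := by
    rintro rfl
    rw [zero_pow (by omega)] at hσ
    norm_num at hσ
  set S : Set (ℝ × (Fin n → ℂ)) := {x | ‖x.2‖ < r ∧ χ x.2 ∈ timeSlice P p v k σ η β x.1} with hS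
  set L : Filter (ℝ × (Fin n → ℂ)) := comap Prod.fst atTop ⊓ 𝓟 S with hL
  have ht : Tendsto Prod.fst L atTop := tendsto_comap.mono_left inf_le_left
  have hmem : ∀ᶠ x in L, x ∈ S := mem_inf_of_right (mem_principal_self S)
  have hκ : 0 < (k : ℝ)⁻¹ := by
    have : (0 : ℝ) < k := by exact_mod_cast hk1
    positivity
  have hzO : (fun x : ℝ × (Fin n → ℂ) => ‖x.2‖) =O[L] fun x => x.1 ^ (-β) := by
    refine IsBigO.of_bound B ?_
    filter_upwards [hmem, ht.eventually_gt_atTop 0] with x hx hx0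
    rw [norm_norm, Real.norm_of_nonneg (by positivity)]
    exact (hBr _ hx.1).trans (mul_le_mul_of_nonneg_left (norm_lt_of_mem_timeSlice hx0 hx.2) hB.le)
  have hz : Tendsto Prod.snd L (𝓝 0) := by
    rw [tendsto_zero_iff_norm_tendsto_zero]
    exact hzO.trans_tendsto ((tendsto_rpow_neg_atTop hβ).comp ht)
  have hrp : ∀ a b : ℝ, a < b → (fun x : ℝ × (Fin n → ℂ) => x.1 ^ (-b)) =o[L]
      fun x => x.1 ^ (-a) := by
    intro a b hab
    have h1 : (fun x : ℝ × (Fin n → ℂ) => x.1 ^ (-(b - a))) =o[L] fun _ => (1 : ℝ) :=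
      (isLittleO_one_iff ℝ).mpr ((tendsto_rpow_neg_atTop (by linarith)).comp ht)
    refine (h1.mul_isBigO (isBigO_refl (fun x : ℝ × (Fin n → ℂ) => x.1 ^ (-a)) L)).congr' ?_
      (Eventually.of_forall fun x => one_mul _)
    filter_upwards [ht.eventually_gt_atTop 0] with x hx0
    rw [← Real.rpow_add hx0]
    congr 1
    ring
  -- The exponent `1 + β + 1 / k` suffices twice: the error must beat `t ^ (-1 - β)` in the
  -- coordinates `w_j`, and `t ^ (-1)` in `u` after rescaling by `t ^ (1 / k)`.
  have hzd : (fun x : ℝ × (Fin n → ℂ) => ‖x.2‖ ^ (d + 1)) =o[L]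
      fun x => x.1 ^ (-(1 + β + (k : ℝ)⁻¹)) := by
    refine (hzO.pow (d + 1)).trans_isLittleO ((hrp _ _ hdβ).congr' ?_ EventuallyEq.rfl)
    filter_upwards [ht.eventually_gt_atTop 0] with x hx0
    rw [← Real.rpow_mul_natCast hx0.le]
    push_cast
    congr 1
    ring
  have hinv : ∀ x : ℝ × (Fin n → ℂ), x.1 ^ (-1 : ℝ) = x.1⁻¹ := fun x => Real.rpow_neg_one _
  have huO : (fun x : ℝ × (Fin n → ℂ) => ‖monomMap P (χ x.2)‖) =O[L]
      fun x => x.1 ^ (-(k : ℝ)⁻¹) := by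
    refine IsBigO.of_bound (‖σ‖ * (‖v‖ + η)) ?_
    filter_upwards [hmem, ht.eventually_gt_atTop 0] with x hx hx0
    have h1 : ‖rescaled k σ x.1 (monomMap P (χ x.2))‖ ≤ ‖v‖ + η := by
      have h2 := norm_add_le v (rescaled k σ x.1 (monomMap P (χ x.2)) - v)
      have h3 := (hp _).trans_lt hx.2.1
      rw [add_sub_cancel] at h2
      linarith
    have h4 : 0 < x.1 ^ (-(k : ℝ)⁻¹) := Real.rpow_pos_of_pos hx0 _
    rw [norm_norm, Real.norm_of_nonneg h4.le]
    conv_lhs => rw [eq_smul_rescaled (k := k) hσ0 hx0 (monomMap P (χ x.2))]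
    rw [norm_smul, norm_mul, Complex.norm_real, Real.norm_of_nonneg h4.le]
    calc _ ≤ ‖σ‖ * x.1 ^ (-(k : ℝ)⁻¹) * (‖v‖ + η) := by gcongr
      _ = _ := by ring
  have hud : (fun x : ℝ × (Fin n → ℂ) => ‖monomMap P (χ x.2)‖ ^ (k + 1)) =o[L]
      fun x => x.1⁻¹ := by
    have h1 := hrp 1 (1 + (k : ℝ)⁻¹) (by linarith)
    simp only [hinv] at h1
    refine (huO.pow (k + 1)).trans_isLittleO (h1.congr' ?_ EventuallyEq.rfl)
    filter_upwards [ht.eventually_gt_atTop 0] with x hx0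
    rw [← Real.rpow_mul_natCast hx0.le]
    push_cast
    congr 1
    have : (k : ℝ) ≠ 0 := by exact_mod_cast (by omega : k ≠ 0)
    field_simp
  have hzd1 : (fun x : ℝ × (Fin n → ℂ) => ‖x.2‖ ^ (d + 1)) =o[L] fun x => x.1⁻¹ := by
    have h1 := hrp 1 (1 + β + (k : ℝ)⁻¹) (by linarith)
    simp only [hinv] at h1
    exact hzd.trans h1
  have hstep := eventually_mem_timeSlice (w := fun x : ℝ × (Fin n → ℂ) => χ x.2)
    (w' := fun x => χ (G x.2)) (q := fun x => q x.2) ht hk1 hσ fiberTerm_smul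
    (fun j => (contDiff_fiberTerm j).continuous) hlam (hres.monomMap_eq_one hlam) hp hC hc hs₀ hA
    hη hβ (fun y hy => (hre y hy).1) (fun y hy => (hre y hy).2) (hmem.mono fun x hx => hx.2)
    (fun j => ((hq1 j).comp_tendsto hz).trans_isLittleO hzd)
    (fun j => ((hq2 j).comp_tendsto hz).trans_isLittleO (hud.add hzd1))
  have hGr : ∀ᶠ x in L, ‖G x.2‖ < r := by
    have := (hG.tendsto.comp hz).norm
    rw [norm_zero] at this
    exact this.eventually_lt_const hr
  have hboth := hGr.and hstep
  rw [hL, eventually_inf_principal, eventually_comap] at hboth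
  obtain ⟨R, hR⟩ := eventually_atTop.mp hboth
  exact ⟨R, fun t ht z hz hzt => hR t ht.le (t, z) rfl ⟨hz, hzt⟩⟩

end InverseBasin

/-- The `k`-th roots of `-1`. -/
lemma exists_roots_neg_one {k : ℕ} (hk : 1 ≤ k) :
    ∃ σ : Fin k → ℂ, Function.Injective σ ∧ ∀ i, σ i ^ k = -1 := by
  obtain ⟨ζ, hζ⟩ := IsAlgClosed.exists_pow_nat_eq (-1 : ℂ) hk
  have hζ0 : ζ ≠ 0 := by
    rintro rfl
    rw [zero_pow (by omega)] at hζ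
    norm_num at hζ
  have hprim := Complex.isPrimitiveRoot_exp k (by omega)
  refine ⟨fun i => ζ * Complex.exp (2 * Real.pi * Complex.I / k) ^ (i : ℕ), fun i j hij => ?_,
    fun i => ?_⟩
  · exact Fin.ext (hprim.pow_inj i.2 j.2 (mul_left_cancel₀ hζ0 hij))
  · rw [mul_pow, hζ, ← pow_mul, mul_comm (i : ℕ), pow_mul, hprim.pow_eq_one, one_pow, mul_one]

lemma exists_pos_forall_lt {ι : Type*} [Finite ι] {η₀ : ℝ} (hη₀ : 0 < η₀) {a : ι → ℝ}
    (ha : ∀ i, 0 < a i) : ∃ η > 0, η ≤ η₀ ∧ ∀ i, 2 * η < a i := by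
  have h1 : ∀ᶠ η : ℝ in 𝓝[>] 0, ∀ i, 2 * η < a i := by
    rw [eventually_all]
    intro i
    filter_upwards [Ioo_mem_nhdsGT (show 0 < a i / 2 by have := ha i; positivity)] with η hη
    linarith [hη.2]
  obtain ⟨η, h2, h3⟩ := (h1.and (Ioo_mem_nhdsGT hη₀)).exists
  exact ⟨η, h3.1, h3.2.le, h2⟩

end MultiResonant

end

theorem corollary5p2 {n m : ℕ} (F : (Fin n → ℂ) → (Fin n → ℂ)) (lam : Fin n → ℂ)
    (P : Fin m → (Fin n →₀ ℕ)) (k₀ : ℕ)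
    (hF : MultiResonant.IsBiholGerm F)
    (hdiag : MultiResonant.HasDiagonalDifferential F lam)
    (hres : MultiResonant.IsResonantWithGenerators lam P)
    (hlam : ∀ j, ‖lam j‖ = 1)
    (hord : MultiResonant.HasWeightedOrder F lam P k₀)
    (hpar : MultiResonant.IsParabolicallyAttracting F lam P k₀) :
    ∃ U : Fin k₀ → Set (Fin n → ℂ),
      (∀ i j, i ≠ j → Disjoint (U i) (U j)) ∧
      ∀ i, MultiResonant.IsRepellingBasin F (U i) ∧ (0 : Fin n → ℂ) ∈ frontier (U i) := by
  open MultiResonant in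
  obtain ⟨G, hG⟩ := hF.exists_inverse
  obtain ⟨N, hNF, hk, v, hv, hvre⟩ := hpar
  rw [shadowH_eq_shadowField] at hv
  have hk1 := hk.one_le
  have hli := hres.linearIndependent
  have hfd : ∀ j, Differentiable ℂ (fiberTerm lam P N k₀ j) :=
    fun j => (contDiff_fiberTerm j).differentiable one_ne_zero
  -- This makes `Fin m → ℂ` nontrivial, as the spectral radius argument requires.
  have : Nonempty (Fin m) := by
    obtain ⟨τ, -⟩ := Function.ne_iff.mp hv.ne_zero
    exact ⟨τ⟩
  have hpos := re_pos_of_directorMap_eigenvalue hk1 (differentiable_shadowField (P := P) hfd v)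
    (shadowField_smul fiberTerm_smul) hv
  obtain ⟨p, hp, ⟨C, hC0, hC⟩, c, hc, s₀, hs₀, hA⟩ := exists_seminorm_contracting _ hpos
  obtain ⟨β, hβ, hβre⟩ := exists_forall_re_lt_neg hvre
  obtain ⟨η₀, hη₀, hre⟩ := exists_slice_width hfd hv.normalized hβre hp hC0 hC hc
  obtain ⟨σ, hσinj, hσ⟩ := exists_roots_neg_one hk1
  have hσ1 : ∀ i, ‖σ i‖ = 1 := fun i => by
    have h1 : ‖σ i‖ ^ k₀ = 1 := by rw [← norm_pow, hσ]; simp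
    exact (pow_eq_one_iff_of_nonneg (norm_nonneg _) (by omega)).mp h1
  have hσ0 : ∀ i, σ i ≠ 0 := fun i h => by simpa [h] using hσ1 i
  have hv0 : 0 < ‖v‖ := norm_pos_iff.mpr hv.ne_zero
  -- Three bounds on the width: `η₀` for the local estimates, `‖v‖ / 2` to keep `0` outside the
  -- basins, and the distances between the phases for disjointness.
  obtain ⟨η, hη, hηη₀, hησ⟩ := exists_pos_forall_lt (ι := {x : Fin k₀ × Fin k₀ // x.1 ≠ x.2})
    (lt_min hη₀ (half_pos hv0)) (a := fun x => ‖σ x.1.1 - σ x.1.2‖ * ‖v‖) fun x =>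
      mul_pos (norm_pos_iff.mpr (sub_ne_zero.mpr (hσinj.ne x.2))) hv0
  have hηv : η < ‖v‖ := (hηη₀.trans (min_le_right _ _)).trans_lt (half_lt_self hv0)
  obtain ⟨d', hd'⟩ := exists_nat_gt ((1 + β + (k₀ : ℝ)⁻¹) / β)
  -- The bound `k₀ ≤ d` keeps the leading resonant terms in the truncation, and `d'` makes the
  -- truncation error negligible.
  set d : ℕ := max k₀ d' with hd
  have hdβ : 1 + β + (k₀ : ℝ)⁻¹ < β * (d + 1) := by
    have h1 : (d' : ℝ) ≤ d := by exact_mod_cast le_max_right _ _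
    rw [div_lt_iff₀ hβ] at hd'
    nlinarith
  obtain ⟨χ, hχ, hχ0, hχm, hχO, hχF⟩ := hNF.exists_jet_conjugation hF.map_zero hli d
  obtain ⟨B, hB, hBb⟩ := hχO.exists_pos
  obtain ⟨r, hr, hball⟩ := Metric.eventually_nhds_iff_ball.mp hBb.bound
  have hBr : ∀ z, ‖z‖ < r → ‖z‖ ≤ B * ‖χ z‖ := fun z hz => hball z (by simpa using hz)
  have hbasin : ∀ i, ∃ U : Set (Fin n → ℂ), IsAttractingBasin G U ∧
      (0 : Fin n → ℂ) ∈ frontier U ∧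
      ∀ z ∈ U, ∃ t > 0, p (rescaled k₀ (σ i) t (monomMap P (χ z)) - v) < η := fun i =>
    exists_basin_of_slices (monomMap_zero hli) hp hC hηv hβ (hσ0 i) hχ hχ0 hχm hr hB hBr
      (eventually_exists_mem_timeSlice hli hC (hσ0 i) hη
        (fun j => (hβre j).trans (by linarith)) hv.normalized
        fun τ hτ => re_factor_lt_of_coord_eq_zero hfd hpos hτ)
      (hG.eventually_step hres hlam hNF.1 hk (le_max_left _ _) hχ hχ0 hχF (hσ i) hp hC hc hs₀ hA
        hη hβ hdβ (fun y hy => hre y (hy.trans_le (hηη₀.trans (min_le_left _ _)))) hB hr hBr)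
  choose U hU hfr hUt using hbasin
  refine ⟨U, fun i j hij => Set.disjoint_left.mpr fun z hzi hzj => ?_,
    fun i => ⟨⟨G, hG, hU i⟩, hfr i⟩⟩
  obtain ⟨t₁, ht₁, h₁⟩ := hUt i z hzi
  obtain ⟨t₂, ht₂, h₂⟩ := hUt j z hzj
  exact disjoint_rescaled (hσ1 i) (hσ1 j) (hησ ⟨(i, j), hij⟩) ht₁ ht₂
    ((hp _).trans_lt h₁) ((hp _).trans_lt h₂)
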